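/- Let $n,k$ be positive integers and $w\in S_n$. For $m\ge 0$ let $\binom{[n]}{m}$ be the set of $m$-subsets of $[n]=\{1,\dots,n\}$, written $[x_1,\dots,x_m]$ with $x_1<\cdots<x_m$, and let $$\mathrm{Inv}_m(w)=\Bigl\{[x_1,\dots,x_m]\in\tbinom{[n]}{m} : w^{-1}(x_1)>\cdots>w^{-1}(x_m)\Bigr\}$$ be the set of $m$-inversions of $w$. For $X=[x_1,\dots,x_m]$ let $X_i=X\setminus\{x_i\}$ and let $P(X)=\{X_1,\dots,X_m\}$ be the packet of $X$, with lex order $(X_m,\dots,X_1)$ and antilex order $(X_1,\dots,X_m)$. A prefix (suffix) of $P(X)$ is a possibly empty initial (final) segment of the lex order. Call $X$ a quasi-inversion if exactly one of the pairs $[x_i,x_j]$, $i<j$, is not a $2$-inversion of $w$. *Permanent poset.* $\mathcal P_w(n,m)$ is the set $\mathrm{Inv}_m(w)$ with the reflexive transitive closure of the quasi-inversion relations: for each quasi-inversion $X\in\binom{[n]}{m+1}$ with $P(X)\cap \mathrm{Inv}_m(w)=\{X_i,X_{i+1}\}$, one has $X_i<X_{i+1}$ if $m-i$ is odd and $X_{i+1}<X_i$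 if $m-i$ is even. *The poset $\mathcal B_w(n,k)$.* A total order $\rho$ of $\mathrm{Inv}_k(w)$ is $k$-admissible if it is a linear extension of $\mathcal P_w(n,k)$ and, for every $X\in\mathrm{Inv}_{k+1}(w)$, its restriction to $P(X)$ is the lex or the antilex order. Let $\mathcal A_w(n,k)$ be the set of $k$-admissible orders, and let $$\mathrm{Rev}_{n,k,w}(\rho)=\{X\in\mathrm{Inv}_{k+1}(w) : \rho|_{P(X)}=(X_1,\dots,X_{k+1})\}.$$ Two elements of $\mathrm{Inv}_k(w)$ commute if they are incomparable in $\mathcal P_w(n,k)$ and lie in no common packet $P(X)$, $X\in\binom{[n]}{k+1}$. A commutation exchanges two adjacent commuting elements of a total order, and $\rho\sim_w\sigma$ if $\sigma$ is obtained from $\rho$ by a sequence of commutations. A lex-to-antilex packet flip at $X\in\mathrm{Inv}_{k+1}(w)$ applies when the elements of $P(X)$ are consecutive in $\rho$ and in lex order, and reverses their order. $\mathcal B_w(n,k)$ is the poset on $\mathcal A_w(n,k)/\!\sim_w$ in which $[\rho]\le[\sigma]$ if $\sigma$ can be obtained from $\rho$ by a sequence of commutations and lex-to-antilex packet flips. *The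 poset $\mathcal C_w(n,k+1)$.* A subset $R\subseteq\mathrm{Inv}_{k+1}(w)$ is consistent if it is a lower order ideal of $\mathcal P_w(n,k+1)$ and, for every $X\in\mathrm{Inv}_{k+2}(w)$, $P(X)\cap R$ is a prefix or a suffix of $P(X)$. $\mathcal C_w(n,k+1)$ is the set of consistent subsets of $\mathrm{Inv}_{k+1}(w)$, ordered by single step inclusion: $R\le S$ if there is a chain of consistent sets from $R$ to $S$, each obtained from the previous one by adding one element. *The graph $G_R$.* For $R\in\mathcal C_w(n,k+1)$ let $G_R$ be the directed graph on $\mathrm{Inv}_k(w)$ with the edges $X\to Y$ for each quasi-inversion relation $X<Y$ of $\mathcal P_w(n,k)$; $X_i\to X_{i+1}$ ($1\le i\le k$) for each $X\in R$; and $X_{i+1}\to X_i$ ($1\le i\le k$) for each $X\in\mathrm{Inv}_{k+1}(w)\setminus R$. Write $Y\le_R Z$ if there is a (possibly trivial) directed path from $Y$ to $Z$ in $G_R$. **Theorem.** For every $R\in\mathcal C_w(n,k+1)$ the graph $G_R$ is acyclic, so that $\le_R$ is a partial order on $\mathrm{Inv}_k(w)$. The map $[\rho]\mapsto\mathrm{Rev}_{n,k,w}(\rho)$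 is a well-defined isomorphism of posets $\mathcal B_w(n,k)\to\mathcal C_w(n,k+1)$, and its inverse sends $R$ to the commutation class consisting of exactly the linear extensions of $(\mathrm{Inv}_k(w),\le_R)$. -/

import Mathlib

/-! The set `[n]` is modelled by `Fin n`, and an ordered subset `[x₁, …, x_k]` (listed in increasing
order) by the finset of its entries.  A total order on a finite set is modelled by the
duplicate-free list of its elements, smallest first. -/

namespace HigherBruhat

variable {n : ℕ}

/-- The set `Inv_k(w)` of `k`-inversions of `w`: the `k`-subsets `[x₁, …, x_k]` with
`w⁻¹(x₁) > ⋯ > w⁻¹(x_k)`. -/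
def Inv (w : Equiv.Perm (Fin n)) (k : ℕ) : Finset (Finset (Fin n)) :=
  (Finset.univ.powersetCard k).filter
    (fun X => ∀ a ∈ X, ∀ b ∈ X, a < b → w⁻¹ b < w⁻¹ a)

/-- The packet `P(X) = {X₁, …, X_k}`, where `X_i` is `X` with its `i`-th entry removed. -/
def packet (X : Finset (Fin n)) : Finset (Finset (Fin n)) :=
  X.image (fun a => X.erase a)

/-- The lexicographic order `(X_k, …, X₁)` on `P(X)`. -/
def lex (X : Finset (Fin n)) : List (Finset (Fin n)) :=
  (X.sort (· ≥ ·)).map (fun a => X.erase a)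

/-- The antilexicographic order `(X₁, …, X_k)` on `P(X)`. -/
def antilex (X : Finset (Fin n)) : List (Finset (Fin n)) :=
  (X.sort (· ≤ ·)).map (fun a => X.erase a)

/-- `S` is a (possibly empty) prefix `{X_k, …, X_i}` of `P(X)`. -/
def IsPrefix (X : Finset (Fin n)) (S : Finset (Finset (Fin n))) : Prop :=
  ∃ m : ℕ, S = ((lex X).take m).toFinset

/-- `S` is a (possibly empty) suffix `{X_i, …, X₁}` of `P(X)`. -/
def IsSuffix (X : Finset (Fin n)) (S : Finset (Finset (Fin n))) : Prop :=
  ∃ m : ℕ, S = ((lex X).drop m).toFinset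

/-- `X` is a quasi-inversion for `w`: exactly one pair of entries of `X` is not an inversion. -/
def IsQuasiInv (w : Equiv.Perm (Fin n)) (X : Finset (Fin n)) : Prop :=
  ∃! p : Fin n × Fin n, p.1 ∈ X ∧ p.2 ∈ X ∧ p.1 < p.2 ∧ ¬ w⁻¹ p.2 < w⁻¹ p.1

/-- `a` and `b` are consecutive entries `x_i`, `x_{i+1}` of `X`. -/
def Consec (X : Finset (Fin n)) (a b : Fin n) : Prop :=
  a ∈ X ∧ b ∈ X ∧ a < b ∧ ∀ c ∈ X, ¬ (a < c ∧ c < b)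

/-- The quasi-inversion relations on `Inv_k(w)`.  If `X` has `k + 1` entries and `a = x_i`,
`b = x_{i+1}`, then the number of entries of `X` above `b` is `k - i`. -/
def QuasiRel (w : Equiv.Perm (Fin n)) (k : ℕ) (Y Z : Finset (Fin n)) : Prop :=
  ∃ (X : Finset (Fin n)) (a b : Fin n), X.card = k + 1 ∧ IsQuasiInv w X ∧ Consec X a b ∧
    packet X ∩ Inv w k = {X.erase a, X.erase b} ∧
    ((Odd (X.filter (fun c => b < c)).card ∧ Y = X.erase a ∧ Z = X.erase b) ∨
      (Even (X.filter (fun c => b < c)).card ∧ Y = X.erase b ∧ Z = X.erase a))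

/-- The order relation of the permanent poset `P_w(n,k)`. -/
def PermLE (w : Equiv.Perm (Fin n)) (k : ℕ) : Finset (Fin n) → Finset (Fin n) → Prop :=
  Relation.ReflTransGen (QuasiRel w k)

/-- `ρ` is a total order of `Inv_k(w)`. -/
def IsTotalOrd (w : Equiv.Perm (Fin n)) (k : ℕ) (ρ : List (Finset (Fin n))) : Prop :=
  ρ.Nodup ∧ ∀ X, X ∈ ρ ↔ X ∈ Inv w k

/-- `ρ` is a linear extension of the relation `le` on `Inv_k(w)`. -/
def IsLinExt (w : Equiv.Perm (Fin n)) (k : ℕ) (le : Finset (Fin n) → Finset (Fin n) → Prop)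
    (ρ : List (Finset (Fin n))) : Prop :=
  IsTotalOrd w k ρ ∧
    ∀ Y ∈ Inv w k, ∀ Z ∈ Inv w k, le Y Z → ρ.idxOf Y ≤ ρ.idxOf Z

/-- The restriction of the total order `ρ` to the packet `P(X)`. -/
def restrict (ρ : List (Finset (Fin n))) (X : Finset (Fin n)) : List (Finset (Fin n)) :=
  ρ.filter (fun Y => Y ∈ packet X)

/-- `ρ` is a `k`-admissible order for `w`. -/
def IsAdmissible (w : Equiv.Perm (Fin n)) (k : ℕ) (ρ : List (Finset (Fin n))) : Prop :=
  IsLinExt w k (PermLE w k) ρ ∧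
    ∀ X ∈ Inv w (k + 1), restrict ρ X = lex X ∨ restrict ρ X = antilex X

/-- The set `A_w(n,k)` of `k`-admissible orders for `w`. -/
abbrev Adm (w : Equiv.Perm (Fin n)) (k : ℕ) : Type :=
  {ρ : List (Finset (Fin n)) // IsAdmissible w k ρ}

/-- The reversal set `Rev_{n,k,w}(ρ)`. -/
def Rev (w : Equiv.Perm (Fin n)) (k : ℕ) (ρ : List (Finset (Fin n))) : Finset (Finset (Fin n)) :=
  (Inv w (k + 1)).filter (fun X => restrict ρ X = antilex X)

/-- `Y` and `Z` commute with respect to `w`. -/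
def Commutes (w : Equiv.Perm (Fin n)) (k : ℕ) (Y Z : Finset (Fin n)) : Prop :=
  Y ∈ Inv w k ∧ Z ∈ Inv w k ∧ ¬ PermLE w k Y Z ∧ ¬ PermLE w k Z Y ∧
    ¬ ∃ X : Finset (Fin n), X.card = k + 1 ∧ Y ∈ packet X ∧ Z ∈ packet X

/-- `σ` is obtained from `ρ` by exchanging two adjacent elements that commute. -/
def CommStep (w : Equiv.Perm (Fin n)) (k : ℕ) (ρ σ : List (Finset (Fin n))) : Prop :=
  ∃ l₁ l₂ Y Z, Commutes w k Y Z ∧ ρ = l₁ ++ [Y, Z] ++ l₂ ∧ σ = l₁ ++ [Z, Y] ++ l₂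

/-- `σ` is obtained from `ρ` by a lex-to-antilex packet flip. -/
def FlipStep (w : Equiv.Perm (Fin n)) (k : ℕ) (ρ σ : List (Finset (Fin n))) : Prop :=
  ∃ l₁ l₂, ∃ X ∈ Inv w (k + 1), ρ = l₁ ++ lex X ++ l₂ ∧ σ = l₁ ++ antilex X ++ l₂

/-- `σ` is obtained from `ρ` by a sequence of commutations and lex-to-antilex packet flips. -/
def Reach (w : Equiv.Perm (Fin n)) (k : ℕ) :
    List (Finset (Fin n)) → List (Finset (Fin n)) → Prop :=
  Relation.ReflTransGen (fun ρ σ => CommStep w k ρ σ ∨ FlipStep w k ρ σ)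

/-- Commutation equivalence of admissible orders. -/
def commSetoid (w : Equiv.Perm (Fin n)) (k : ℕ) : Setoid (Adm w k) :=
  (Relation.EqvGen.setoid (CommStep w k)).comap Subtype.val

/-- The underlying set `A_w(n,k)/∼` of the higher Bruhat order `B_w(n,k)`. -/
def B (w : Equiv.Perm (Fin n)) (k : ℕ) : Type := Quotient (commSetoid w k)

/-- The commutation class `[ρ]`. -/
def cls {w : Equiv.Perm (Fin n)} {k : ℕ} (ρ : Adm w k) : B w k := Quotient.mk (commSetoid w k) ρ

/-! ### Facts that make `B_w(n,k)` a poset -/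

theorem CommStep.symm {w : Equiv.Perm (Fin n)} {k : ℕ} {ρ σ : List (Finset (Fin n))}
    (h : CommStep w k ρ σ) : CommStep w k σ ρ := by
  obtain ⟨l₁, l₂, Y, Z, ⟨h1, h2, h3, h4, h5⟩, rfl, rfl⟩ := h
  exact ⟨l₁, l₂, Z, Y, ⟨h2, h1, h4, h3, fun ⟨X, a, b, c⟩ => h5 ⟨X, a, c, b⟩⟩, rfl, rfl⟩

theorem reach_of_eqv {w : Equiv.Perm (Fin n)} {k : ℕ} {ρ σ : List (Finset (Fin n))}
    (h : Relation.EqvGen (CommStep w k) ρ σ) : Reach w k ρ σ ∧ Reach w k σ ρ := by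
  induction h with
  | rel x y h => exact ⟨.single (Or.inl h), .single (Or.inl h.symm)⟩
  | refl x => exact ⟨.refl, .refl⟩
  | symm x y _ ih => exact ih.symm
  | trans x y z _ _ ih1 ih2 => exact ⟨ih1.1.trans ih2.1, ih2.2.trans ih1.2⟩

theorem antilex_eq_reverse (X : Finset (Fin n)) : antilex X = (lex X).reverse := by
  unfold antilex lex
  rw [← List.map_reverse]
  congr 1
  apply List.Perm.eq_of_pairwise (le := (· ≤ ·))
  · intro a b _ _ h1 h2
    exact le_antisymm h1 h2
  · exact Finset.pairwise_sort X _
  · rw [List.pairwise_reverse]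
    exact Finset.pairwise_sort X (· ≥ ·)
  · exact ((Finset.sort_perm_toList _ _).trans (Finset.sort_perm_toList _ _).symm).trans
      (List.reverse_perm _).symm

theorem mem_lex {X Y : Finset (Fin n)} : Y ∈ lex X ↔ Y ∈ packet X := by
  simp [lex, packet]

/-- Two distinct packets share at most one element. -/
theorem packet_inter {k : ℕ} {X X' Y Z : Finset (Fin n)} (hX : X.card = k + 1)
    (hX' : X'.card = k + 1) (hne : X ≠ X') (hY : Y ∈ packet X) (hY' : Y ∈ packet X')
    (hZ : Z ∈ packet X) (hZ' : Z ∈ packet X') : Y = Z := by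
  have key : ∀ T, T ∈ packet X → T ∈ packet X' → T = X ∩ X' := by
    intro T h h'
    simp only [packet, Finset.mem_image] at h h'
    obtain ⟨a, ha, rfl⟩ := h
    obtain ⟨b, hb, hab⟩ := h'
    apply Finset.eq_of_subset_of_card_le
    · apply Finset.subset_inter (Finset.erase_subset _ _)
      rw [← hab]
      exact Finset.erase_subset _ _
    · rw [Finset.card_erase_of_mem ha, hX]
      have : (X ∩ X').card < X.card := by
        apply Finset.card_lt_card
        refine ⟨Finset.inter_subset_left, fun hs => hne ?_⟩
        exact Finset.eq_of_subset_of_card_le (fun x hx => (Finset.mem_inter.1 (hs hx)).2)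
          (by rw [hX, hX'])
      omega
  rw [key Y hY hY', key Z hZ hZ']

theorem restrict_comm {w : Equiv.Perm (Fin n)} {k : ℕ} {ρ σ : List (Finset (Fin n))}
    (h : CommStep w k ρ σ) {X : Finset (Fin n)} (hX : X.card = k + 1) :
    restrict ρ X = restrict σ X := by
  obtain ⟨l₁, l₂, Y, Z, ⟨h1, h2, h3, h4, h5⟩, rfl, rfl⟩ := h
  have h6 : ¬ (Y ∈ packet X ∧ Z ∈ packet X) := fun h => h5 ⟨X, hX, h.1, h.2⟩
  by_cases hY : Y ∈ packet X <;> by_cases hZ : Z ∈ packet X <;>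
    simp_all [restrict]

theorem card_of_mem_Inv {w : Equiv.Perm (Fin n)} {k : ℕ} {X : Finset (Fin n)}
    (h : X ∈ Inv w k) : X.card = k := by
  simp only [Inv, Finset.mem_filter, Finset.mem_powersetCard] at h
  exact h.1.2

theorem lex_nodup (X : Finset (Fin n)) : (lex X).Nodup := by
  unfold lex
  refine List.Nodup.map_on ?_ (Finset.sort_nodup _ _)
  intro a ha b hb hab
  rw [Finset.mem_sort] at ha hb
  by_contra hne
  have h1 : a ∈ X.erase b := Finset.mem_erase.2 ⟨hne, ha⟩
  have h2 : X.erase a = X.erase b := hab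
  rw [← h2] at h1
  simp at h1

theorem step_perm {w : Equiv.Perm (Fin n)} {k : ℕ} {ρ σ : List (Finset (Fin n))}
    (h : CommStep w k ρ σ ∨ FlipStep w k ρ σ) : ρ.Perm σ := by
  rcases h with ⟨l₁, l₂, Y, Z, _, rfl, rfl⟩ | ⟨l₁, l₂, X, _, rfl, rfl⟩
  · exact ((List.Perm.swap Z Y []).append_left l₁).append_right l₂
  · rw [antilex_eq_reverse]
    exact ((List.reverse_perm _).symm.append_left l₁).append_right l₂

theorem Rev_comm {w : Equiv.Perm (Fin n)} {k : ℕ} {ρ σ : List (Finset (Fin n))}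
    (h : CommStep w k ρ σ) : Rev w k ρ = Rev w k σ := by
  unfold Rev
  apply Finset.filter_congr
  intro X hX
  rw [restrict_comm h (card_of_mem_Inv hX)]

theorem Rev_flip {w : Equiv.Perm (Fin n)} {k : ℕ} {ρ σ : List (Finset (Fin n))}
    (hn : ρ.Nodup) (h : FlipStep w k ρ σ) :
    Rev w k ρ ⊆ Rev w k σ ∧ (Rev w k ρ = Rev w k σ → ρ = σ) := by
  obtain ⟨l₁, l₂, X, hX, rfl, rfl⟩ := h
  have hd1 : ∀ Y ∈ l₁, Y ∉ packet X := by
    intro Y hY hp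
    rw [List.append_assoc] at hn
    exact (List.disjoint_of_nodup_append hn) hY
      (List.mem_append_left _ (mem_lex.2 hp))
  have hd2 : ∀ Y ∈ l₂, Y ∉ packet X := by
    intro Y hY hp
    exact (List.disjoint_of_nodup_append hn) (List.mem_append_right _ (mem_lex.2 hp)) hY
  have hres : ∀ L : List (Finset (Fin n)), (∀ Y ∈ L, Y ∈ packet X) →
      restrict (l₁ ++ L ++ l₂) X = L := by
    intro L hL
    have e1 : l₁.filter (fun Y => decide (Y ∈ packet X)) = [] := by
      simpa [List.filter_eq_nil_iff] using hd1
    have e2 : l₂.filter (fun Y => decide (Y ∈ packet X)) = [] := by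
      simpa [List.filter_eq_nil_iff] using hd2
    have e3 : L.filter (fun Y => decide (Y ∈ packet X)) = L := by
      simpa [List.filter_eq_self] using hL
    simp only [restrict, List.filter_append, e1, e2, e3, List.nil_append, List.append_nil]
  have hρ := hres (lex X) (fun Y hY => mem_lex.1 hY)
  have hσ := hres (antilex X) (fun Y hY => by
    rw [antilex_eq_reverse, List.mem_reverse] at hY
    exact mem_lex.1 hY)
  have hXσ : X ∈ Rev w k (l₁ ++ antilex X ++ l₂) := Finset.mem_filter.2 ⟨hX, hσ⟩
  refine ⟨?_, ?_⟩
  · intro X' hX'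
    by_cases hne : X = X'
    · rw [← hne]
      exact hXσ
    · obtain ⟨hI, hr⟩ := Finset.mem_filter.1 hX'
      refine Finset.mem_filter.2 ⟨hI, ?_⟩
      rw [← hr]
      have hrev : ((lex X).filter (fun Y => decide (Y ∈ packet X'))).reverse =
          (lex X).filter (fun Y => decide (Y ∈ packet X')) := by
        have hall : ∀ Y ∈ (lex X).filter (fun Y => decide (Y ∈ packet X')),
            ∀ Z ∈ (lex X).filter (fun Y => decide (Y ∈ packet X')), Y = Z := by
          intro Y hY Z hZ
          simp only [List.mem_filter, decide_eq_true_eq, mem_lex] at hY hZ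
          exact packet_inter (card_of_mem_Inv hX) (card_of_mem_Inv hI) hne hY.1 hY.2 hZ.1 hZ.2
        generalize (lex X).filter (fun Y => decide (Y ∈ packet X')) = L at hall
        cases L with
        | nil => rfl
        | cons a t =>
          have := List.eq_replicate_of_mem (a := a) (l := a :: t)
            (fun b hb => hall b hb a List.mem_cons_self)
          rw [this, List.reverse_replicate]
      simp only [restrict, List.filter_append, antilex_eq_reverse, List.filter_reverse, hrev]
  · intro he
    rw [← he] at hXσ
    have := (Finset.mem_filter.1 hXσ).2
    rw [hρ] at this
    rw [this]

theorem reach_nodup {w : Equiv.Perm (Fin n)} {k : ℕ} {ρ σ : List (Finset (Fin n))}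
    (hn : ρ.Nodup) (h : Reach w k ρ σ) :
    σ.Nodup ∧ Rev w k ρ ⊆ Rev w k σ ∧
      (Rev w k ρ = Rev w k σ → Relation.EqvGen (CommStep w k) ρ σ) := by
  induction h with
  | refl => exact ⟨hn, subset_rfl, fun _ => .refl _⟩
  | @tail τ σ _ hs ih =>
    obtain ⟨h1, h2, h3⟩ := ih
    refine ⟨(step_perm hs).nodup_iff.1 h1, ?_⟩
    rcases hs with hs | hs
    · rw [← Rev_comm hs]
      exact ⟨h2, fun he => (h3 he).trans _ _ _ (.rel _ _ hs)⟩
    · obtain ⟨h4, h5⟩ := Rev_flip h1 hs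
      refine ⟨h2.trans h4, fun he => ?_⟩
      have e1 : Rev w k ρ = Rev w k τ := h2.antisymm (he ▸ h4)
      rw [← h5 (e1 ▸ he)]
      exact h3 e1

/-- The higher Bruhat order `B_w(n,k)`: `[ρ] ≤ [σ]` if `σ` can be obtained from `ρ` by a sequence
of commutations and lex-to-antilex packet flips. -/
instance instPartialOrderB (w : Equiv.Perm (Fin n)) (k : ℕ) : PartialOrder (B w k) where
  le := Quotient.lift₂ (fun ρ σ : Adm w k => Reach w k ρ.1 σ.1) (by
    intro a₁ b₁ a₂ b₂ ha hb
    have ha' := reach_of_eqv (w := w) (k := k) ha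
    have hb' := reach_of_eqv (w := w) (k := k) hb
    exact propext ⟨fun h => (ha'.2.trans h).trans hb'.1, fun h => (ha'.1.trans h).trans hb'.2⟩)
  le_refl := by
    rintro ⟨a⟩
    exact Relation.ReflTransGen.refl
  le_trans := by
    rintro ⟨a⟩ ⟨b⟩ ⟨c⟩ h1 h2
    exact Relation.ReflTransGen.trans h1 h2
  le_antisymm := by
    rintro ⟨a⟩ ⟨b⟩ h1 h2
    have h3 := reach_nodup a.2.1.1.1 h1
    have h4 := reach_nodup b.2.1.1.1 h2
    exact Quotient.sound (s := commSetoid w k) (h3.2.2 (h3.2.1.antisymm h4.2.1))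

/-- `R ⊆ Inv_k(w)` is consistent: it is a lower order ideal of the permanent poset `P_w(n,k)` and
meets the packet of every `(k + 1)`-inversion in a prefix or a suffix. -/
def IsConsistent (w : Equiv.Perm (Fin n)) (k : ℕ) (R : Finset (Finset (Fin n))) : Prop :=
  R ⊆ Inv w k ∧ (∀ Y ∈ R, ∀ Z ∈ Inv w k, PermLE w k Z Y → Z ∈ R) ∧
    ∀ X ∈ Inv w (k + 1), IsPrefix X (packet X ∩ R) ∨ IsSuffix X (packet X ∩ R)

/-- The set `C_w(n,k)` of consistent subsets of `Inv_k(w)`. -/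
def C (w : Equiv.Perm (Fin n)) (k : ℕ) : Type :=
  {R : Finset (Finset (Fin n)) // IsConsistent w k R}

/-- `S` is obtained from `R` by adding one element. -/
def SingleStep {w : Equiv.Perm (Fin n)} {k : ℕ} (R S : C w k) : Prop :=
  ∃ X, X ∉ R.1 ∧ S.1 = insert X R.1

theorem subset_of_steps {w : Equiv.Perm (Fin n)} {k : ℕ} {R S : C w k}
    (h : Relation.ReflTransGen SingleStep R S) : R.1 ⊆ S.1 := by
  induction h with
  | refl => exact subset_rfl
  | tail _ hs ih =>
    obtain ⟨X, _, hX⟩ := hs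
    rw [hX]
    exact ih.trans (Finset.subset_insert _ _)

/-- The poset `C_w(n,k)`, ordered by single step inclusion. -/
instance instPartialOrderC (w : Equiv.Perm (Fin n)) (k : ℕ) : PartialOrder (C w k) where
  le := Relation.ReflTransGen SingleStep
  le_refl _ := .refl
  le_trans _ _ _ h1 h2 := h1.trans h2
  le_antisymm _ _ h1 h2 := Subtype.ext ((subset_of_steps h1).antisymm (subset_of_steps h2))

/-- The edges of the directed graph `G_R` on `Inv_k(w)`, for `R ⊆ Inv_{k+1}(w)`. -/
def GEdge (w : Equiv.Perm (Fin n)) (k : ℕ) (R : Finset (Finset (Fin n)))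
    (Y Z : Finset (Fin n)) : Prop :=
  QuasiRel w k Y Z ∨
    (∃ X ∈ R, ∃ a b, Consec X a b ∧ Y = X.erase a ∧ Z = X.erase b) ∨
    (∃ X ∈ Inv w (k + 1) \ R, ∃ a b, Consec X a b ∧ Y = X.erase b ∧ Z = X.erase a)

/-- `G_R` has no directed cycle. -/
def GAcyclic (w : Equiv.Perm (Fin n)) (k : ℕ) (R : Finset (Finset (Fin n))) : Prop :=
  ∀ Y, ¬ Relation.TransGen (GEdge w k R) Y Y

/-- The relation `≤_R` on `Inv_k(w)` induced by `G_R`: reachability along directed paths. -/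
def GLE (w : Equiv.Perm (Fin n)) (k : ℕ) (R : Finset (Finset (Fin n))) :
    Finset (Fin n) → Finset (Fin n) → Prop :=
  Relation.ReflTransGen (GEdge w k R)

end HigherBruhat

/-! The heart of the matter is acyclicity. For an entry `p`, the function `level` takes the values
0, 1, 2 and equals 1 exactly on the sets containing `p`. Along edges of `G_R` whose ends have the
same entries above `p`, it never decreases (`level_le_of_edge`): this combines the prefix-or-suffix
condition at `X ∪ {p}` with the ideal property of `R` at quasi-inversions. Hence along a directed
cycle the level of the largest entry is constant, so the vertices agree on containing it; the same
then holds for the next entry, and so on down. All vertices would coincide, but no edge is a loop.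

For an inversion `X` with `k + 1` entries, `G_R` chains the packet of `X` in antilex order if `X ∈
R` and in lex order otherwise. As `k ≥ 1`, these orders differ, so the linear extensions of `≤_R`
are precisely the admissible orders with reversal set `R` (`isLinExt_GLE_iff`). Elements unrelated
in `G_R` commute, and two linear extensions differ by exchanges of adjacent unrelated elements, so
these orders form one commutation class (`IsLinExt.eqvGen_commStep`), nonempty by acyclicity.
Reversal sets are consistent because a violation would put three elements of `Inv_k(w)` in cyclic
order.

For the order relations, a packet flip adds at most one element to the reversal set. Conversely, if
`R` and `R ∪ {X}` are both consistent, the packet of `X` is convex in `G_R`: a path leaving and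
re-entering it would close to a cycle in `G_R` or in `G_{R ∪ {X}}`. So some linear extension of
`≤_R` has this packet consecutive, and flipping it realizes the single step (`exists_flipStep`). -/

namespace HigherBruhat

variable {n : ℕ}

/-! ### Inversions and quasi-inversions -/

/-- Every pair of entries of `X` is an inversion of `w`. -/
def AllInv (w : Equiv.Perm (Fin n)) (X : Finset (Fin n)) : Prop :=
  ∀ a ∈ X, ∀ b ∈ X, a < b → w⁻¹ b < w⁻¹ a

theorem mem_Inv {w : Equiv.Perm (Fin n)} {k : ℕ} {X : Finset (Fin n)} :
    X ∈ Inv w k ↔ X.card = k ∧ AllInv w X := by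
  simp [Inv, AllInv, Finset.mem_powersetCard]

theorem AllInv.subset {w : Equiv.Perm (Fin n)} {X Y : Finset (Fin n)} (h : AllInv w X)
    (hY : Y ⊆ X) : AllInv w Y :=
  fun a ha b hb => h a (hY ha) b (hY hb)

theorem erase_mem_Inv {w : Equiv.Perm (Fin n)} {k : ℕ} {X : Finset (Fin n)}
    (h : X ∈ Inv w (k + 1)) {a : Fin n} (ha : a ∈ X) : X.erase a ∈ Inv w k := by
  rw [mem_Inv] at h ⊢
  exact ⟨by rw [Finset.card_erase_of_mem ha, h.1]; rfl, h.2.subset (Finset.erase_subset _ _)⟩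

theorem erase_inj_mem {X : Finset (Fin n)} {a b : Fin n} (ha : a ∈ X)
    (h : X.erase a = X.erase b) : a = b := by
  by_contra hne
  have h1 : a ∈ X.erase b := Finset.mem_erase.2 ⟨hne, ha⟩
  rw [← h] at h1
  simp at h1

/-- The pair `a < b` is the only pair of entries of `X` that is not an inversion of `w`. -/
structure QuasiAt (w : Equiv.Perm (Fin n)) (X : Finset (Fin n)) (a b : Fin n) : Prop where
  left_mem : a ∈ X
  right_mem : b ∈ X
  lt : a < b
  not_inv : w⁻¹ a < w⁻¹ b
  inv_of_ne : ∀ c ∈ X, ∀ d ∈ X, c < d → ¬ (c = a ∧ d = b) → w⁻¹ d < w⁻¹ c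

namespace QuasiAt

variable {w : Equiv.Perm (Fin n)} {X : Finset (Fin n)} {a b : Fin n}

theorem not_allInv (h : QuasiAt w X a b) : ¬ AllInv w X :=
  fun h' => lt_asymm h.not_inv (h' a h.left_mem b h.right_mem h.lt)

theorem isQuasiInv (h : QuasiAt w X a b) : IsQuasiInv w X := by
  refine ⟨(a, b), ⟨h.left_mem, h.right_mem, h.lt, h.not_inv.not_gt⟩, ?_⟩
  rintro ⟨c, d⟩ ⟨hc, hd, hcd, hn⟩
  by_contra hne
  exact hn (h.inv_of_ne c hc d hd hcd fun ⟨h1, h2⟩ => hne (by rw [h1, h2]))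

/-- An entry `c` strictly between would make `(a, c)` and `(c, b)` inversions, hence `(a, b)` as
well by transitivity. -/
theorem consec (h : QuasiAt w X a b) : Consec X a b := by
  refine ⟨h.left_mem, h.right_mem, h.lt, fun c hc ⟨hac, hcb⟩ => ?_⟩
  have h1 := h.inv_of_ne a h.left_mem c hc hac (fun e => hcb.ne e.2)
  have h2 := h.inv_of_ne c hc b h.right_mem hcb (fun e => hac.ne' e.1)
  exact lt_asymm h.not_inv (h2.trans h1)

theorem allInv_erase_left (h : QuasiAt w X a b) : AllInv w (X.erase a) := by
  intro c hc d hd hcd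
  rw [Finset.mem_erase] at hc hd
  exact h.inv_of_ne c hc.2 d hd.2 hcd fun e => hc.1 e.1

theorem allInv_erase_right (h : QuasiAt w X a b) : AllInv w (X.erase b) := by
  intro c hc d hd hcd
  rw [Finset.mem_erase] at hc hd
  exact h.inv_of_ne c hc.2 d hd.2 hcd fun e => hd.1 e.2

/-- Removing any third entry leaves the bad pair `a < b` in place. -/
theorem packet_inter_Inv {k : ℕ} (h : QuasiAt w X a b) (hX : X.card = k + 1) :
    packet X ∩ Inv w k = {X.erase a, X.erase b} := by
  ext Y
  simp only [packet, Finset.mem_inter, Finset.mem_image, Finset.mem_insert, Finset.mem_singleton,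
    mem_Inv]
  constructor
  · rintro ⟨⟨c, hc, rfl⟩, _, hI⟩
    by_contra hne
    push Not at hne
    have ha : a ∈ X.erase c := Finset.mem_erase.2 ⟨fun e => hne.1 (by rw [e]), h.left_mem⟩
    have hb : b ∈ X.erase c := Finset.mem_erase.2 ⟨fun e => hne.2 (by rw [e]), h.right_mem⟩
    exact lt_asymm h.not_inv (hI a ha b hb h.lt)
  · rintro (rfl | rfl)
    · exact ⟨⟨a, h.left_mem, rfl⟩, by rw [Finset.card_erase_of_mem h.left_mem, hX]; rfl,
        h.allInv_erase_left⟩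
    · exact ⟨⟨b, h.right_mem, rfl⟩, by rw [Finset.card_erase_of_mem h.right_mem, hX]; rfl,
        h.allInv_erase_right⟩

theorem erase {c : Fin n} (h : QuasiAt w X a b) (ha : c ≠ a) (hb : c ≠ b) :
    QuasiAt w (X.erase c) a b where
  left_mem := Finset.mem_erase.2 ⟨ha.symm, h.left_mem⟩
  right_mem := Finset.mem_erase.2 ⟨hb.symm, h.right_mem⟩
  lt := h.lt
  not_inv := h.not_inv
  inv_of_ne x hx y hy := h.inv_of_ne x (Finset.mem_of_mem_erase hx) y (Finset.mem_of_mem_erase hy)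

end QuasiAt

/-- If both `X ∖ a` and `X ∖ b` are inversions, then `X` is an inversion, or a quasi-inversion at
the pair `a < b`. -/
theorem allInv_or_quasiAt {w : Equiv.Perm (Fin n)} {X : Finset (Fin n)} {a b : Fin n} (ha : a ∈ X)
    (hb : b ∈ X) (hab : a < b) (hXa : AllInv w (X.erase a)) (hXb : AllInv w (X.erase b)) :
    (w⁻¹ b < w⁻¹ a ∧ AllInv w X) ∨ QuasiAt w X a b := by
  have key : ∀ c ∈ X, ∀ d ∈ X, c < d → ¬ (c = a ∧ d = b) → w⁻¹ d < w⁻¹ c := by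
    intro c hc d hd hcd hne
    by_cases h1 : c = a
    · have h2 : d ≠ b := fun h2 => hne ⟨h1, h2⟩
      have h3 : c ≠ b := by rw [h1]; exact hab.ne
      exact hXb c (Finset.mem_erase.2 ⟨h3, hc⟩) d (Finset.mem_erase.2 ⟨h2, hd⟩) hcd
    · by_cases h2 : d = a
      · have h3 : c ≠ b := by
          rintro rfl
          exact lt_asymm hcd (h2 ▸ hab)
        have h4 : d ≠ b := by rw [h2]; exact hab.ne
        exact hXb c (Finset.mem_erase.2 ⟨h3, hc⟩) d (Finset.mem_erase.2 ⟨h4, hd⟩) hcd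
      · exact hXa c (Finset.mem_erase.2 ⟨h1, hc⟩) d (Finset.mem_erase.2 ⟨h2, hd⟩) hcd
  rcases lt_trichotomy (w⁻¹ b) (w⁻¹ a) with h | h | h
  · refine Or.inl ⟨h, fun c hc d hd hcd => ?_⟩
    by_cases e : c = a ∧ d = b
    · rw [e.1, e.2]; exact h
    · exact key c hc d hd hcd e
  · exact absurd (w⁻¹.injective h) hab.ne'
  · exact Or.inr ⟨ha, hb, hab, h, key⟩

/-- The packet condition makes `X ∖ a` and `X ∖ b` inversions, which forces the unique bad pair of
`X` to be `(a, b)`; consecutivity and the packet condition are then automatic. -/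
theorem quasiRel_iff {w : Equiv.Perm (Fin n)} {k : ℕ} {Y Z : Finset (Fin n)} :
    QuasiRel w k Y Z ↔ ∃ (X : Finset (Fin n)) (a b : Fin n), X.card = k + 1 ∧ QuasiAt w X a b ∧
      ((Odd (X.filter (fun c => b < c)).card ∧ Y = X.erase a ∧ Z = X.erase b) ∨
        (Even (X.filter (fun c => b < c)).card ∧ Y = X.erase b ∧ Z = X.erase a)) := by
  constructor
  · rintro ⟨X, a, b, hX, hq, hc, hp, h⟩
    refine ⟨X, a, b, hX, ?_, h⟩
    have hm : ∀ u, u = a ∨ u = b → AllInv w (X.erase u) := by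
      intro u hu
      have : X.erase u ∈ packet X ∩ Inv w k := by
        rw [hp]
        rcases hu with rfl | rfl <;> simp
      exact (mem_Inv.1 (Finset.mem_inter.1 this).2).2
    rcases allInv_or_quasiAt hc.1 hc.2.1 hc.2.2.1 (hm a (Or.inl rfl)) (hm b (Or.inr rfl)) with
      h1 | h1
    · obtain ⟨p, ⟨h2, h3, h4, h5⟩, _⟩ := hq
      exact absurd (h1.2 p.1 h2 p.2 h3 h4) h5
    · exact h1
  · rintro ⟨X, a, b, hX, hq, h⟩
    exact ⟨X, a, b, hX, hq.isQuasiInv, hq.consec, hq.packet_inter_Inv hX, h⟩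

theorem QuasiRel.mem {w : Equiv.Perm (Fin n)} {k : ℕ} {Y Z : Finset (Fin n)}
    (h : QuasiRel w k Y Z) : Y ∈ Inv w k ∧ Z ∈ Inv w k := by
  obtain ⟨X, a, b, hX, hq, h⟩ := quasiRel_iff.1 h
  have h1 : X.erase a ∈ packet X ∩ Inv w k := by rw [hq.packet_inter_Inv hX]; simp
  have h2 : X.erase b ∈ packet X ∩ Inv w k := by rw [hq.packet_inter_Inv hX]; simp
  rw [Finset.mem_inter] at h1 h2
  rcases h with ⟨_, rfl, rfl⟩ | ⟨_, rfl, rfl⟩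
  exacts [⟨h1.2, h2.2⟩, ⟨h2.2, h1.2⟩]

theorem QuasiRel.of_odd {w : Equiv.Perm (Fin n)} {k : ℕ} {X : Finset (Fin n)} {a b : Fin n}
    (hX : X.card = k + 1) (h : QuasiAt w X a b) (ho : Odd (X.filter (fun c => b < c)).card) :
    QuasiRel w k (X.erase a) (X.erase b) :=
  quasiRel_iff.2 ⟨X, a, b, hX, h, Or.inl ⟨ho, rfl, rfl⟩⟩

theorem QuasiRel.of_even {w : Equiv.Perm (Fin n)} {k : ℕ} {X : Finset (Fin n)} {a b : Fin n}
    (hX : X.card = k + 1) (h : QuasiAt w X a b) (he : Even (X.filter (fun c => b < c)).card) :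
    QuasiRel w k (X.erase b) (X.erase a) :=
  quasiRel_iff.2 ⟨X, a, b, hX, h, Or.inr ⟨he, rfl, rfl⟩⟩

/-! ### Prefixes and suffixes of a packet -/

theorem pairwise_mem_take {α : Type*} {l : List α} (hl : l.Nodup) (m : ℕ) :
    l.Pairwise (fun x y => y ∈ l.take m → x ∈ l.take m) := by
  induction l generalizing m with
  | nil => simp
  | cons x t ih =>
    rw [List.nodup_cons] at hl
    cases m with
    | zero => simp [List.pairwise_iff_forall_sublist]
    | succ m =>
      simp only [List.take_succ_cons, List.pairwise_cons, List.mem_cons, true_or, implies_true,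
        true_and]
      refine (ih hl.2 m).imp_of_mem ?_
      intro u v hu hv h h'
      rcases h' with rfl | h'
      · exact absurd hv hl.1
      · exact Or.inr (h h')

theorem mem_drop_iff {α : Type*} {l : List α} (hl : l.Nodup) (m : ℕ) (x : α) :
    x ∈ l.drop m ↔ x ∈ l ∧ x ∉ l.take m := by
  have h1 := List.take_append_drop m l
  have hd := hl
  rw [← h1] at hd
  have hdis := List.disjoint_of_nodup_append hd
  constructor
  · exact fun h => ⟨List.mem_of_mem_drop h, fun h' => hdis h' h⟩
  · rintro ⟨h, h'⟩
    rw [← h1, List.mem_append] at h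
    exact h.resolve_left h'

/-- A property closed towards the front of a list cuts out an initial segment. -/
theorem exists_take_of_pairwise {α : Type*} {l : List α} {p : α → Prop}
    (h : l.Pairwise (fun x y => p y → p x)) : ∃ m, ∀ x, x ∈ l.take m ↔ x ∈ l ∧ p x := by
  induction l with
  | nil => exact ⟨0, by simp⟩
  | cons a t ih =>
    rw [List.pairwise_cons] at h
    obtain ⟨m, hm⟩ := ih h.2
    by_cases ha : p a
    · refine ⟨m + 1, fun x => ?_⟩
      simp only [List.take_succ_cons, List.mem_cons, hm]
      constructor
      · rintro (rfl | h')
        exacts [⟨Or.inl rfl, ha⟩, ⟨Or.inr h'.1, h'.2⟩]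
      · rintro ⟨rfl | h1, h2⟩
        exacts [Or.inl rfl, Or.inr ⟨h1, h2⟩]
    · refine ⟨0, fun x => ?_⟩
      simp only [List.take_zero, List.not_mem_nil, List.mem_cons, false_iff, not_and]
      rintro (rfl | hx) hp
      exacts [ha hp, ha (h.1 x hx hp)]

/-- A property that holds for all ordered pairs of entries may be checked on the sorted list. -/
theorem pairwise_lex_iff {X : Finset (Fin n)} {p : Finset (Fin n) → Finset (Fin n) → Prop} :
    (lex X).Pairwise p ↔ ∀ a ∈ X, ∀ b ∈ X, a < b → p (X.erase b) (X.erase a) := by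
  have hs : (X.sort (· ≥ ·)).Pairwise (· > ·) :=
    (Finset.sortedGT_sort X).pairwise
  rw [lex, List.pairwise_map]
  constructor
  · intro h a ha b hb
    -- The list is decreasing, so the implication `u < v → _` is vacuous for pairs in list order;
    -- its content is in the flipped pairs.
    exact List.Pairwise.forall_of_forall_of_flip
      (R := fun u v => u < v → p (X.erase v) (X.erase u))
      (fun x _ h => absurd h (lt_irrefl _)) (hs.imp fun h1 h2 => absurd h2 (lt_asymm h1))
      (by refine h.imp ?_; intro u v h1 _; exact h1)
      (by simpa using ha) (by simpa using hb)
  · intro h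
    refine hs.imp_of_mem ?_
    intro u v hu hv huv
    exact h v (by simpa using hv) u (by simpa using hu) huv

theorem pairwise_antilex_iff {X : Finset (Fin n)} {p : Finset (Fin n) → Finset (Fin n) → Prop} :
    (antilex X).Pairwise p ↔ ∀ a ∈ X, ∀ b ∈ X, a < b → p (X.erase a) (X.erase b) := by
  rw [antilex_eq_reverse, List.pairwise_reverse, pairwise_lex_iff]

theorem erase_mem_packet {X : Finset (Fin n)} {a : Fin n} (ha : a ∈ X) : X.erase a ∈ packet X :=
  Finset.mem_image_of_mem _ ha

/-- The lex order lists `X ∖ a` by decreasing `a`, so a prefix is a part of the packet closed under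
increasing the removed entry. -/
theorem isPrefix_iff {X : Finset (Fin n)} {R : Finset (Finset (Fin n))} :
    IsPrefix X (packet X ∩ R) ↔
      ∀ a ∈ X, ∀ b ∈ X, a < b → X.erase a ∈ R → X.erase b ∈ R := by
  have hR : ∀ a ∈ X, (X.erase a ∈ R ↔ X.erase a ∈ packet X ∩ R) := fun a ha => by
    simp [erase_mem_packet ha]
  constructor
  · rintro ⟨m, hm⟩ a ha b hb hab h
    rw [hR a ha, hm, List.mem_toFinset] at h
    rw [hR b hb, hm, List.mem_toFinset]
    exact pairwise_lex_iff.1 (pairwise_mem_take (lex_nodup X) m) a ha b hb hab h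
  · intro h
    obtain ⟨m, hm⟩ := exists_take_of_pairwise (p := (· ∈ R)) (pairwise_lex_iff (X := X).2 h)
    refine ⟨m, ?_⟩
    ext Y
    rw [List.mem_toFinset, hm, mem_lex, Finset.mem_inter]

theorem isSuffix_iff {X : Finset (Fin n)} {R : Finset (Finset (Fin n))} :
    IsSuffix X (packet X ∩ R) ↔
      ∀ a ∈ X, ∀ b ∈ X, a < b → X.erase b ∈ R → X.erase a ∈ R := by
  have hR : ∀ a ∈ X, (X.erase a ∈ R ↔ X.erase a ∈ packet X ∩ R) := fun a ha => by
    simp [erase_mem_packet ha]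
  constructor
  · rintro ⟨m, hm⟩ a ha b hb hab h
    rw [hR b hb, hm, List.mem_toFinset, mem_drop_iff (lex_nodup X)] at h
    rw [hR a ha, hm, List.mem_toFinset, mem_drop_iff (lex_nodup X)]
    refine ⟨mem_lex.2 (erase_mem_packet ha), fun h' => h.2 ?_⟩
    exact pairwise_lex_iff.1 (pairwise_mem_take (lex_nodup X) m) a ha b hb hab h'
  · intro h
    obtain ⟨m, hm⟩ := exists_take_of_pairwise (p := (· ∉ R)) (pairwise_lex_iff (X := X).2
      (fun a ha b hb hab hn h' => hn (h a ha b hb hab h')))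
    refine ⟨m, ?_⟩
    ext Y
    rw [List.mem_toFinset, mem_drop_iff (lex_nodup X), hm, mem_lex, Finset.mem_inter]
    tauto

/-- `R` meets the packet of `X` in a prefix or a suffix if and only if membership in `R` does not
change twice along the packet. -/
theorem isPrefix_or_isSuffix_iff {X : Finset (Fin n)} {R : Finset (Finset (Fin n))} :
    (IsPrefix X (packet X ∩ R) ∨ IsSuffix X (packet X ∩ R)) ↔
      ∀ a ∈ X, ∀ b ∈ X, ∀ c ∈ X, a < b → b < c → (X.erase a ∈ R ↔ X.erase c ∈ R) →
        (X.erase b ∈ R ↔ X.erase a ∈ R) := by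
  rw [isPrefix_iff, isSuffix_iff]
  constructor
  · rintro (h | h) a ha b hb c hc hab hbc hac
    · exact ⟨fun h1 => hac.2 (h b hb c hc hbc h1), h a ha b hb hab⟩
    · exact ⟨h a ha b hb hab, fun h1 => h b hb c hc hbc (hac.1 h1)⟩
  · intro h
    by_contra hcon
    push Not at hcon
    obtain ⟨⟨a, ha, b, hb, hab, h1, h2⟩, c, hc, d, hd, hcd, h3, h4⟩ := hcon
    -- Both conditions fail: along `a < b` membership goes from true to false, along `c < d` from
    -- false to true. The triple `a < b < d` or `c < d < b` then changes twice.
    rcases lt_trichotomy b d with hbd | rfl | hbd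
    · exact h2 ((h a ha b hb d hd hab hbd (by tauto)).2 h1)
    · exact h2 h3
    · exact h4 ((h c hc d hd b hb hcd hbd (by tauto)).1 h3)

/-! ### Acyclicity of `G_R` -/

/-- Position of `Y` relative to the entry `p`: the sets that contain `p` have level `1`, and the
others lie below or above them in `G_R`. -/
def level (w : Equiv.Perm (Fin n)) (k : ℕ) (R : Finset (Finset (Fin n))) (p : Fin n)
    (Y : Finset (Fin n)) : ℕ :=
  if p ∈ Y then 1
  else if insert p Y ∈ R then 2
  else if insert p Y ∈ Inv w (k + 1) then 0
  -- For a quasi-inversion at `a < p`, the edge between `X ∖ a` (level 1) and `X ∖ p` points towards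
  -- `X ∖ p` exactly when the number of entries above `p` is odd; the last two values follow this
  -- direction.
  else if Even (Y.filter (fun c => p < c)).card then 0
  else 2

section level

variable {w : Equiv.Perm (Fin n)} {k : ℕ} {R : Finset (Finset (Fin n))} {p : Fin n}
  {X Y Z : Finset (Fin n)} {a b : Fin n}

theorem level_of_mem (h : p ∈ Y) : level w k R p Y = 1 := by
  simp [level, h]

theorem level_of_mem_R (h : p ∉ Y) (hR : insert p Y ∈ R) : level w k R p Y = 2 := by
  simp [level, h, hR]

theorem level_of_mem_Inv (h : p ∉ Y) (hR : insert p Y ∉ R) (hI : insert p Y ∈ Inv w (k + 1)) :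
    level w k R p Y = 0 := by
  simp [level, h, hR, hI]

theorem level_of_even (h : p ∉ Y) (hR : insert p Y ∉ R)
    (he : Even (Y.filter (fun c => p < c)).card) : level w k R p Y = 0 := by
  simp [level, h, hR, he]

theorem level_of_odd (h : p ∉ Y) (hR : insert p Y ∉ R) (hI : insert p Y ∉ Inv w (k + 1))
    (ho : ¬ Even (Y.filter (fun c => p < c)).card) : level w k R p Y = 2 := by
  simp only [level, h, hR, hI, ho, if_false]

theorem level_eq_one_iff : level w k R p Y = 1 ↔ p ∈ Y := by
  unfold level
  split_ifs <;> simp_all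

/-- With an even number of entries above `p`, level 2 means exactly `insert p Y ∈ R`; with an odd
number, level 0 means exactly that `insert p Y` is an inversion outside `R`. Monotonicity is one
implication in each case. -/
theorem level_le_of (hY : p ∉ Y) (hZ : p ∉ Z)
    (hYZ : Y.filter (fun c => p < c) = Z.filter (fun c => p < c))
    (he : Even (Z.filter (fun c => p < c)).card → insert p Y ∈ R → insert p Z ∈ R)
    (ho : Odd (Z.filter (fun c => p < c)).card → insert p Z ∈ Inv w (k + 1) →
      insert p Z ∉ R → insert p Y ∈ Inv w (k + 1) ∧ insert p Y ∉ R) :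
    level w k R p Y ≤ level w k R p Z := by
  rw [← Nat.not_even_iff_odd] at ho
  unfold level
  rw [hYZ]
  split_ifs <;> simp_all

end level

theorem IsConsistent.mem_of_quasiRel {w : Equiv.Perm (Fin n)} {k : ℕ}
    {R : Finset (Finset (Fin n))} (hR : IsConsistent w k R) {Y Z : Finset (Fin n)}
    (h : QuasiRel w k Y Z) (hZ : Z ∈ R) : Y ∈ R :=
  hR.2.1 Z hZ Y h.mem.1 (.single h)

/-- If `X` is an inversion with entries `a < b < p` and `X ∪ p ∖ a` is an inversion, so is
`X ∪ p`. -/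
theorem allInv_insert_of_erase {w : Equiv.Perm (Fin n)} {X : Finset (Fin n)} {p a b : Fin n}
    (ha : a ∈ X) (hb : b ∈ X) (hab : a < b) (hbp : b < p) (hX : AllInv w X)
    (h : AllInv w ((insert p X).erase a)) : AllInv w (insert p X) := by
  have hpb : w⁻¹ p < w⁻¹ b := h b (by simp [hb, hab.ne']) p
    (by simp [(hab.trans hbp).ne']) hbp
  have hpa : w⁻¹ p < w⁻¹ a := hpb.trans (hX a ha b hb hab)
  intro c hc d hd hcd
  by_cases hca : c = a
  · subst hca
    rcases Finset.mem_insert.1 hd with rfl | hd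
    · exact hpa
    · exact hX c ha d hd hcd
  · by_cases hda : d = a
    · subst hda
      rcases Finset.mem_insert.1 hc with rfl | hc
      · exact absurd (hab.trans hbp) (lt_asymm hcd)
      · exact hX c hc d ha hcd
    · exact h c (Finset.mem_erase.2 ⟨hca, hc⟩) d (Finset.mem_erase.2 ⟨hda, hd⟩) hcd

theorem insert_erase_eq {X : Finset (Fin n)} {p a : Fin n} (hpa : p ≠ a) :
    insert p (X.erase a) = (insert p X).erase a :=
  (Finset.erase_insert_of_ne hpa).symm

theorem filter_insert_lt {X : Finset (Fin n)} {p b : Fin n} (hbp : b < p) (hp : p ∉ X) :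
    ((insert p X).filter (fun c => b < c)).card = (X.filter (fun c => b < c)).card + 1 := by
  rw [Finset.filter_insert, if_pos hbp, Finset.card_insert_of_notMem]
  simp [hp]

/-! ### Monotonicity of the level along the edges of `G_R` -/

section edges

variable {w : Equiv.Perm (Fin n)} {k : ℕ} {R : Finset (Finset (Fin n))} {p : Fin n}
  {X : Finset (Fin n)} {a b : Fin n}

theorem filter_insert_self_lt : (insert p X).filter (fun c => p < c) =
    X.filter (fun c => p < c) := by
  rw [Finset.filter_insert, if_neg (lt_irrefl p)]

theorem filter_erase_lt (h : a ≤ p) : (X.erase a).filter (fun c => p < c) =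
    X.filter (fun c => p < c) := by
  ext c
  simp only [Finset.mem_filter, Finset.mem_erase]
  constructor
  · exact fun h1 => ⟨h1.1.2, h1.2⟩
  · exact fun h1 => ⟨⟨(h.trans_lt h1.2).ne', h1.1⟩, h1.2⟩

theorem insert_mem_Inv_iff (hX : X.card = k + 1) (hp : p ∉ X) (ha : a ∈ X) (hap : a < p) :
    insert p (X.erase a) ∈ Inv w (k + 1) ↔ AllInv w ((insert p X).erase a) := by
  rw [insert_erase_eq hap.ne', mem_Inv, Finset.card_erase_of_mem (by simp [ha]),
    Finset.card_insert_of_notMem hp, hX]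
  simp

/-- If `b = p`, the level rises from 1 to 2. If `X ∪ {p}` is an inversion, its packet contains `X ∈
R` at the end `p`, so membership in `R` at `a` passes to the intermediate `b`. Otherwise the level
could drop only if `X ∪ {p}` were a quasi-inversion at `b < p` with odd parity, and there the
relation `(X ∪ {p}) ∖ b < X` and the ideal property prevent it. -/
theorem level_le_of_mem (hR : IsConsistent w (k + 1) R) (hX : X ∈ R) (ha : a ∈ X) (hb : b ∈ X)
    (hab : a < b) (hbp : b ≤ p) :
    level w k R p (X.erase a) ≤ level w k R p (X.erase b) := by
  have hXI := mem_Inv.1 (hR.1 hX)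
  have hap : a < p := hab.trans_le hbp
  rcases hbp.eq_or_lt with rfl | hbp
  · rw [level_of_mem (Finset.mem_erase.2 ⟨hab.ne', hb⟩),
      level_of_mem_R (by simp) (by rwa [Finset.insert_erase hb])]
    norm_num
  by_cases hp : p ∈ X
  · rw [level_of_mem (Finset.mem_erase.2 ⟨hap.ne', hp⟩),
      level_of_mem (Finset.mem_erase.2 ⟨hbp.ne', hp⟩)]
  have hX' : (insert p X).card = k + 2 := by rw [Finset.card_insert_of_notMem hp, hXI.1]
  have ha' : a ∈ insert p X := by simp [ha]
  have hb' : b ∈ insert p X := by simp [hb]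
  have hp' : p ∈ insert p X := by simp
  have hXp : (insert p X).erase p = X := Finset.erase_insert hp
  by_cases hI : AllInv w (insert p X)
  · have hmono : insert p (X.erase a) ∈ R → insert p (X.erase b) ∈ R := by
      rw [insert_erase_eq hap.ne', insert_erase_eq hbp.ne']
      intro h
      have := isPrefix_or_isSuffix_iff.1 (hR.2.2 (insert p X) (mem_Inv.2 ⟨hX', hI⟩)) a ha' b hb' p
        hp' hab hbp
      rw [hXp] at this
      exact (this (by tauto)).2 h
    refine level_le_of (by simp [hp]) (by simp [hp]) ?_ (fun _ => hmono) ?_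
    · rw [filter_erase_lt hap.le, filter_erase_lt hbp.le]
    · intro _ _ h
      exact ⟨(insert_mem_Inv_iff hXI.1 hp ha hap).2 (hI.subset (Finset.erase_subset _ _)),
        fun h' => h (hmono h')⟩
  · refine level_le_of (by simp [hp]) (by simp [hp]) ?_ ?_ ?_
    · rw [filter_erase_lt hap.le, filter_erase_lt hbp.le]
    · intro _ h
      exact absurd (allInv_insert_of_erase ha hb hab hbp hXI.2
        ((insert_mem_Inv_iff hXI.1 hp ha hap).1 (hR.1 h))) hI
    · intro ho h1 h2
      rw [insert_mem_Inv_iff hXI.1 hp hb hbp] at h1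
      rw [insert_erase_eq hbp.ne'] at h2
      have hq := (allInv_or_quasiAt hb' hp' hbp h1 (hXp.symm ▸ hXI.2)).resolve_left
        fun h => hI h.2
      rw [filter_erase_lt hbp.le] at ho
      exact absurd (hR.mem_of_quasiRel (QuasiRel.of_odd hX' hq
        (by rwa [filter_insert_self_lt])) (hXp.symm ▸ hX)) h2

/-- The mirror image of `level_le_of_mem`: in the quasi-inversion case at `b < p` the parity is
even, the relation is `X < (X ∪ {p}) ∖ b`, and a drop would force `X ∈ R`. -/
theorem level_le_of_notMem (hR : IsConsistent w (k + 1) R) (hXI : X ∈ Inv w (k + 1)) (hX : X ∉ R)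
    (ha : a ∈ X) (hb : b ∈ X) (hab : a < b) (hbp : b ≤ p) :
    level w k R p (X.erase b) ≤ level w k R p (X.erase a) := by
  have hXI' := hXI
  rw [mem_Inv] at hXI
  have hap : a < p := hab.trans_le hbp
  rcases hbp.eq_or_lt with rfl | hbp
  · rw [level_of_mem (Finset.mem_erase.2 ⟨hab.ne', hb⟩),
      level_of_mem_Inv (by simp) (by rwa [Finset.insert_erase hb])
      (by rwa [Finset.insert_erase hb])]
    norm_num
  by_cases hp : p ∈ X
  · rw [level_of_mem (Finset.mem_erase.2 ⟨hap.ne', hp⟩),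
      level_of_mem (Finset.mem_erase.2 ⟨hbp.ne', hp⟩)]
  have hX' : (insert p X).card = k + 2 := by rw [Finset.card_insert_of_notMem hp, hXI.1]
  have ha' : a ∈ insert p X := by simp [ha]
  have hb' : b ∈ insert p X := by simp [hb]
  have hp' : p ∈ insert p X := by simp
  have hXp : (insert p X).erase p = X := Finset.erase_insert hp
  by_cases hI : AllInv w (insert p X)
  · have hmono : insert p (X.erase b) ∈ R → insert p (X.erase a) ∈ R := by
      rw [insert_erase_eq hap.ne', insert_erase_eq hbp.ne']
      intro h
      have := isPrefix_or_isSuffix_iff.1 (hR.2.2 (insert p X) (mem_Inv.2 ⟨hX', hI⟩)) a ha' b hb' p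
        hp' hab hbp
      rw [hXp] at this
      by_contra hn
      exact hn ((this (by tauto)).1 h)
    refine level_le_of (by simp [hp]) (by simp [hp]) ?_ (fun _ => hmono) ?_
    · rw [filter_erase_lt hap.le, filter_erase_lt hbp.le]
    · intro _ _ h
      exact ⟨(insert_mem_Inv_iff hXI.1 hp hb hbp).2 (hI.subset (Finset.erase_subset _ _)),
        fun h' => h (hmono h')⟩
  · refine level_le_of (by simp [hp]) (by simp [hp]) ?_ ?_ ?_
    · rw [filter_erase_lt hap.le, filter_erase_lt hbp.le]
    · intro he h
      have h1 := hR.1 h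
      rw [insert_mem_Inv_iff hXI.1 hp hb hbp] at h1
      rw [insert_erase_eq hbp.ne'] at h
      have hq := (allInv_or_quasiAt hb' hp' hbp h1 (hXp.symm ▸ hXI.2)).resolve_left
        fun h => hI h.2
      rw [filter_erase_lt hap.le] at he
      have := hR.mem_of_quasiRel (QuasiRel.of_even hX' hq
        (by rwa [filter_insert_self_lt])) h
      rw [hXp] at this
      exact absurd this hX
    · intro _ h1 _
      exact absurd (allInv_insert_of_erase ha hb hab hbp hXI.2
        ((insert_mem_Inv_iff hXI.1 hp ha hap).1 h1)) hI

/-- If `X` is a quasi-inversion at `a < b`, the pair `a < p` is an inversion, and one of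
`X ∪ p ∖ a`, `X ∪ p ∖ b` is an inversion, then both are. -/
theorem QuasiAt.allInv_insert_erase (hq : QuasiAt w X a b) (hp : p ∉ X) (hbp : b < p)
    (hap : w⁻¹ p < w⁻¹ a) (h : AllInv w ((insert p X).erase a) ∨ AllInv w ((insert p X).erase b)) :
    AllInv w ((insert p X).erase a) ∧ AllInv w ((insert p X).erase b) := by
  have hpb : w⁻¹ p < w⁻¹ b := hap.trans hq.not_inv
  have ha := hq.left_mem
  have hb := hq.right_mem
  have key : ∀ c ∈ X, (c < p → w⁻¹ p < w⁻¹ c) ∧ (p < c → w⁻¹ c < w⁻¹ p) := by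
    intro c hc
    by_cases hca : c = a
    · subst hca
      exact ⟨fun _ => hap, fun h => absurd (hq.lt.trans hbp) (lt_asymm h)⟩
    by_cases hcb : c = b
    · subst hcb
      exact ⟨fun _ => hpb, fun h => absurd hbp (lt_asymm h)⟩
    rcases h with h | h
    · have h1 : c ∈ (insert p X).erase a := by simp [hca, hc]
      have h2 : p ∈ (insert p X).erase a := by simp [(hq.lt.trans hbp).ne']
      exact ⟨h c h1 p h2, h p h2 c h1⟩
    · have h1 : c ∈ (insert p X).erase b := by simp [hcb, hc]
      have h2 : p ∈ (insert p X).erase b := by simp [hbp.ne']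
      exact ⟨h c h1 p h2, h p h2 c h1⟩
  have main : ∀ u, AllInv w (X.erase u) → AllInv w ((insert p X).erase u) := by
    intro u hu c hc d hd hcd
    rw [Finset.mem_erase, Finset.mem_insert] at hc hd
    rcases hc with ⟨hcu, rfl | hc⟩
    · rcases hd with ⟨hdu, rfl | hd⟩
      · exact absurd hcd (lt_irrefl _)
      · exact (key d hd).2 hcd
    · rcases hd with ⟨hdu, rfl | hd⟩
      · exact (key c hc).1 hcd
      · exact hu c (Finset.mem_erase.2 ⟨hcu, hc⟩) d (Finset.mem_erase.2 ⟨hdu, hd⟩) hcd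
  exact ⟨main a hq.allInv_erase_left, main b hq.allInv_erase_right⟩

/-- If `b = p`, the parity convention in `level` is what is needed. For new `p > b`, if both
enlarged sets are inversions then `X ∪ {p}` is a quasi-inversion at the same pair with one more
entry above `b`: the relation one rank up is reversed, and an ideal contains the smaller element, so
membership in `R` increases along the original edge. If neither is an inversion, parity gives both
the same level. -/
theorem level_le_of_quasiAt (hR : IsConsistent w (k + 1) R) (hX : X.card = k + 1)
    (hq : QuasiAt w X a b) (hbp : b ≤ p) :
    (Odd (X.filter (fun c => b < c)).card →
      level w k R p (X.erase a) ≤ level w k R p (X.erase b)) ∧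
    (Even (X.filter (fun c => b < c)).card →
      level w k R p (X.erase b) ≤ level w k R p (X.erase a)) := by
  have ha := hq.left_mem
  have hb := hq.right_mem
  have hab := hq.lt
  have hap : a < p := hab.trans_le hbp
  rcases hbp.eq_or_lt with rfl | hbp
  · have hXI : X ∉ Inv w (k + 1) := fun h => hq.not_allInv (mem_Inv.1 h).2
    have hXR : X ∉ R := fun h => hXI (hR.1 h)
    rw [level_of_mem (Y := X.erase a) (Finset.mem_erase.2 ⟨hab.ne', hb⟩)]
    constructor
    · intro ho
      rw [level_of_odd (by simp) (by rwa [Finset.insert_erase hb]) (by rwa [Finset.insert_erase hb])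
        (by rwa [filter_erase_lt le_rfl, Nat.not_even_iff_odd])]
      norm_num
    · intro he
      rw [level_of_even (by simp) (by rwa [Finset.insert_erase hb])
        (by rwa [filter_erase_lt le_rfl])]
      norm_num
  by_cases hp : p ∈ X
  · rw [level_of_mem (Finset.mem_erase.2 ⟨hap.ne', hp⟩),
      level_of_mem (Finset.mem_erase.2 ⟨hbp.ne', hp⟩)]
    exact ⟨fun _ => le_rfl, fun _ => le_rfl⟩
  have hX' : (insert p X).card = k + 2 := by rw [Finset.card_insert_of_notMem hp, hX]
  have ha' : a ∈ insert p X := by simp [ha]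
  have hb' : b ∈ insert p X := by simp [hb]
  have hpa : p ∉ X.erase a := by simp [hp]
  have hpb : p ∉ X.erase b := by simp [hp]
  have hfa : (X.erase a).filter (fun c => p < c) = X.filter (fun c => p < c) :=
    filter_erase_lt hap.le
  have hfb : (X.erase b).filter (fun c => p < c) = X.filter (fun c => p < c) :=
    filter_erase_lt hbp.le
  have hIa := insert_mem_Inv_iff (w := w) hX hp ha hap
  have hIb := insert_mem_Inv_iff (w := w) hX hp hb hbp
  by_cases hca : AllInv w ((insert p X).erase a)
  · by_cases hcb : AllInv w ((insert p X).erase b)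
    · have hq' := (allInv_or_quasiAt ha' hb' hab hca hcb).resolve_left
        fun h => lt_asymm hq.not_inv h.1
      constructor
      · intro ho
        have hrel := QuasiRel.of_even hX' hq'
          (by rw [filter_insert_lt hbp hp]; exact ho.add_one)
        have hmono : insert p (X.erase a) ∈ R → insert p (X.erase b) ∈ R := by
          rw [insert_erase_eq hap.ne', insert_erase_eq hbp.ne']
          exact hR.mem_of_quasiRel hrel
        exact level_le_of hpa hpb (by rw [hfa, hfb]) (fun _ => hmono)
          fun _ _ h => ⟨hIa.2 hca, fun h' => h (hmono h')⟩
      · intro he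
        have hrel := QuasiRel.of_odd hX' hq'
          (by rw [filter_insert_lt hbp hp]; exact he.add_one)
        have hmono : insert p (X.erase b) ∈ R → insert p (X.erase a) ∈ R := by
          rw [insert_erase_eq hap.ne', insert_erase_eq hbp.ne']
          exact hR.mem_of_quasiRel hrel
        exact level_le_of hpb hpa (by rw [hfa, hfb]) (fun _ => hmono)
          fun _ _ h => ⟨hIb.2 hcb, fun h' => h (hmono h')⟩
    · have hap' : w⁻¹ a < w⁻¹ p := by
        rcases lt_trichotomy (w⁻¹ a) (w⁻¹ p) with h | h | h
        · exact h
        · exact absurd (w⁻¹.injective h) hap.ne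
        · exact absurd (hq.allInv_insert_erase hp hbp h (Or.inl hca)).2 hcb
      -- An entry `c` between `b` and `p` would make `(a, c)` and `(c, p)` inversions, hence `(a,
      -- p)`. So the parities at `b` and at `p` agree.
      have hcount : X.filter (fun c => b < c) = X.filter (fun c => p < c) := by
        refine Finset.filter_congr fun c hc => ⟨fun hbc => ?_, fun h => hbp.trans h⟩
        by_contra hcp
        have hcp : c < p := lt_of_le_of_ne (not_lt.1 hcp) (fun e => hp (e ▸ hc))
        have h1 := hca c (by simp [hc, (hab.trans hbc).ne']) p (by simp [hap.ne']) hcp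
        have h2 := hq.inv_of_ne a ha c hc (hab.trans hbc) (fun e => hbc.ne' e.2)
        exact lt_asymm hap' (h1.trans h2)
      have hnI : insert p (X.erase b) ∉ Inv w (k + 1) := fun h => hcb (hIb.1 h)
      have hnR : insert p (X.erase b) ∉ R := fun h => hnI (hR.1 h)
      rw [hcount]
      constructor
      · intro ho
        refine level_le_of hpa hpb (by rw [hfa, hfb]) (fun he => ?_) (fun _ h => absurd h hnI)
        rw [hfb] at he
        exact absurd he (Nat.not_even_iff_odd.2 ho)
      · intro he
        rw [level_of_even hpb hnR (by rwa [hfb])]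
        exact Nat.zero_le _
  · by_cases hcb : AllInv w ((insert p X).erase b)
    -- This case is void: `(X ∪ {p}) ∖ b` contains the pair `a < p`, which is then an inversion and
    -- makes the other enlarged set an inversion too.
    · have h1 := hcb a (by simp [ha, hab.ne]) p (by simp [hbp.ne']) hap
      exact absurd (hq.allInv_insert_erase hp hbp h1 (Or.inr hcb)).1 hca
    · have h1 : insert p (X.erase a) ∉ Inv w (k + 1) := fun h => hca (hIa.1 h)
      have h2 : insert p (X.erase b) ∉ Inv w (k + 1) := fun h => hcb (hIb.1 h)
      exact ⟨fun _ => level_le_of hpa hpb (by rw [hfa, hfb]) (fun _ h => absurd (hR.1 h) h1)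
          (fun _ h => absurd h h2),
        fun _ => level_le_of hpb hpa (by rw [hfa, hfb]) (fun _ h => absurd (hR.1 h) h2)
          (fun _ h => absurd h h1)⟩

end edges

theorem le_of_filter_erase_eq {X : Finset (Fin n)} {a b : Fin n} {m : ℕ} (ha : a ∈ X) (hb : b ∈ X)
    (hab : a ≠ b) (h : (X.erase a).filter (fun c => m ≤ c.val) =
      (X.erase b).filter (fun c => m ≤ c.val)) : a.val < m ∧ b.val < m := by
  simp only [Finset.ext_iff, Finset.mem_filter, Finset.mem_erase] at h
  have h1 := h a
  have h2 := h b
  simp only [ne_eq, not_true_eq_false, false_and, ha, hab, hab.symm, hb, not_false_eq_true,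
    true_and, and_self, iff_false, false_iff, not_le] at h1 h2
  exact ⟨h1, h2⟩

/-- An edge joins some `X ∖ a` and `X ∖ b`; agreement above `p` forces `a, b ≤ p`, the range where
the three kinds of edges are monotone. -/
theorem level_le_of_edge {w : Equiv.Perm (Fin n)} {k : ℕ} {R : Finset (Finset (Fin n))}
    (hR : IsConsistent w (k + 1) R) {p : Fin n} {Y Z : Finset (Fin n)} (h : GEdge w k R Y Z)
    (hYZ : Y.filter (fun c => p.val + 1 ≤ c.val) = Z.filter (fun c => p.val + 1 ≤ c.val)) :
    level w k R p Y ≤ level w k R p Z := by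
  rcases h with h | ⟨X, hX, a, b, ⟨ha, hb, hab, _⟩, rfl, rfl⟩ |
    ⟨X, hX, a, b, ⟨ha, hb, hab, _⟩, rfl, rfl⟩
  · obtain ⟨X, a, b, hX, hq, ⟨ho, rfl, rfl⟩ | ⟨he, rfl, rfl⟩⟩ := quasiRel_iff.1 h
    · have := le_of_filter_erase_eq hq.left_mem hq.right_mem hq.lt.ne hYZ
      exact (level_le_of_quasiAt hR hX hq (Nat.lt_succ_iff.1 this.2)).1 ho
    · have := le_of_filter_erase_eq hq.left_mem hq.right_mem hq.lt.ne hYZ.symm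
      exact (level_le_of_quasiAt hR hX hq (Nat.lt_succ_iff.1 this.2)).2 he
  · have := le_of_filter_erase_eq ha hb hab.ne hYZ
    exact level_le_of_mem hR hX ha hb hab (Nat.lt_succ_iff.1 this.2)
  · have := le_of_filter_erase_eq ha hb hab.ne hYZ.symm
    rw [Finset.mem_sdiff] at hX
    exact level_le_of_notMem hR hX.1 hX.2 ha hb hab (Nat.lt_succ_iff.1 this.2)

theorem GEdge.ne {w : Equiv.Perm (Fin n)} {k : ℕ} {R : Finset (Finset (Fin n))}
    {Y Z : Finset (Fin n)} (h : GEdge w k R Y Z) : Y ≠ Z := by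
  rcases h with h | ⟨X, hX, a, b, ⟨ha, hb, hab, _⟩, rfl, rfl⟩ |
    ⟨X, hX, a, b, ⟨ha, hb, hab, _⟩, rfl, rfl⟩
  · obtain ⟨X, a, b, hX, hq, ⟨ho, rfl, rfl⟩ | ⟨he, rfl, rfl⟩⟩ := quasiRel_iff.1 h
    · exact fun h => hq.lt.ne (erase_inj_mem hq.left_mem h)
    · exact fun h => hq.lt.ne' (erase_inj_mem hq.right_mem h)
  · exact fun h => hab.ne (erase_inj_mem ha h)
  · exact fun h => hab.ne' (erase_inj_mem hb h)

/-- A relation is acyclic if some function is monotone along it and the relation is acyclic on the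
fibres of the function. -/
theorem acyclic_of_monotone {α : Type*} {r s : α → α → Prop} (f : α → ℕ)
    (hf : ∀ x y, r x y → f x ≤ f y) (hs : ∀ x y, r x y → f x = f y → s x y)
    (h : ∀ x, ¬ Relation.TransGen s x x) (x : α) : ¬ Relation.TransGen r x x := by
  have key : ∀ y z, Relation.TransGen r y z → f y ≤ f z ∧ (f y = f z → Relation.TransGen s y z) := by
    intro y z hyz
    induction hyz with
    | single h1 => exact ⟨hf _ _ h1, fun e => .single (hs _ _ h1 e)⟩
    | tail _ h1 ih =>
      refine ⟨ih.1.trans (hf _ _ h1), fun e => ?_⟩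
      have e1 := le_antisymm ih.1 ((hf _ _ h1).trans e.ge)
      exact (ih.2 e1).tail (hs _ _ h1 (e1.symm.trans e))
  exact fun hx => h x ((key x x hx).2 rfl)

/-- The graph `G_R` of a consistent set `R` is acyclic. -/
theorem gAcyclic {w : Equiv.Perm (Fin n)} {k : ℕ} {R : Finset (Finset (Fin n))}
    (hR : IsConsistent w (k + 1) R) : GAcyclic w k R := by
  -- Only edges preserving all entries `≥ m` are kept. For `m = 0` they would be loops, and for `m =
  -- n` nothing is discarded.
  have main : ∀ m ≤ n, ∀ Y, ¬ Relation.TransGen (fun Y Z => GEdge w k R Y Z ∧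
      Y.filter (fun c => m ≤ c.val) = Z.filter (fun c => m ≤ c.val)) Y Y := by
    intro m
    induction m with
    | zero =>
      intro _ Y hY
      cases hY with
      | single h => exact h.1.ne rfl
      | tail _ h =>
        refine h.1.ne ?_
        simpa using h.2
    | succ m ih =>
      intro hm
      have hmn : m < n := hm
      -- Equal level at the entry `m` means equal membership of `m`, so edges within a fibre of the
      -- level also preserve the entry `m`.
      refine acyclic_of_monotone (level w k R ⟨m, hmn⟩) (fun Y Z h => level_le_of_edge hR h.1 h.2)
        ?_ (ih hmn.le)
      intro Y Z h e
      refine ⟨h.1, ?_⟩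
      have hmem : (⟨m, hmn⟩ : Fin n) ∈ Y ↔ (⟨m, hmn⟩ : Fin n) ∈ Z := by
        rw [← level_eq_one_iff (w := w) (k := k) (R := R), e, level_eq_one_iff]
      ext c
      have h2 := Finset.ext_iff.1 h.2 c
      simp only [Finset.mem_filter] at h2 ⊢
      rcases (Nat.lt_trichotomy c.val m) with hc | hc | hc
      · simp [hc]
      · have : c = ⟨m, hmn⟩ := Fin.ext hc
        rw [this, hmem]
      · have h3 : m + 1 ≤ c.val := hc
        simp only [h3, and_true] at h2
        rw [h2]
  intro Y hY
  refine main n le_rfl Y (Relation.TransGen.mono (fun U V h => ⟨h, ?_⟩) _ _ hY)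
  ext c
  simp

/-! ### Linear extensions of acyclic relations -/

/-- Every finite set can be listed compatibly with an acyclic relation. -/
theorem exists_list_of_acyclic {α : Type*} [DecidableEq α] {r : α → α → Prop}
    (hr : ∀ x, ¬ Relation.TransGen r x x) (S : Finset α) :
    ∃ l : List α, l.Nodup ∧ (∀ x, x ∈ l ↔ x ∈ S) ∧ l.Pairwise (fun x y => ¬ r y x) := by
  classical
  -- Acyclicity is antisymmetry of reachability; the resulting partial order is extended to a linear
  -- one, by which `S` is sorted.
  have hpo : IsPartialOrder α (Relation.ReflTransGen r) :=
    { refl := fun _ => .refl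
      trans := fun _ _ _ => .trans
      antisymm := fun a b hab hba => by
        rcases Relation.reflTransGen_iff_eq_or_transGen.1 hab with h | h
        · exact h.symm
        · exact absurd (h.trans_left hba) (hr a) }
  obtain ⟨s, hs, hrs⟩ := extend_partialOrder (Relation.ReflTransGen r)
  refine ⟨S.sort s, Finset.sort_nodup _ _, fun x => Finset.mem_sort _, ?_⟩
  refine ((Finset.pairwise_sort S s).imp₂ (S := (· ≠ ·)) (T := fun x y => ¬ r y x) ?_
    (Finset.sort_nodup S s))
  intro x y hxy hne hyx
  exact hne (hs.antisymm _ _ hxy (hrs _ _ (.single hyx)))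

/-- Two lists of the same elements that are compatible with `r` differ by exchanges of adjacent
elements that are not related by `r`. -/
theorem eqvGen_swap {α : Type*} {r : α → α → Prop} {s : List α → List α → Prop}
    {P : α → Prop}
    (hstep : ∀ l₁ l₂ a b, P a → P b → a ≠ b → ¬ r a b → ¬ r b a →
      s (l₁ ++ [a, b] ++ l₂) (l₁ ++ [b, a] ++ l₂))
    (l l' : List α) (hP : ∀ x ∈ l, P x) (hperm : l.Perm l') (hnd : l.Nodup)
    (h : l.Pairwise (fun x y => ¬ r y x)) (h' : l'.Pairwise (fun x y => ¬ r y x))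
    (pre : List α) : Relation.EqvGen s (pre ++ l) (pre ++ l') := by
  induction l generalizing l' pre with
  | nil =>
    rw [List.nil_perm.1 hperm]
    exact .refl _
  | cons a t ih =>
    have ha : a ∈ l' := hperm.subset List.mem_cons_self
    obtain ⟨p, q, rfl⟩ := List.append_of_mem ha
    have hperm' : t.Perm (p ++ q) := (hperm.trans List.perm_middle).cons_inv
    have hsub : (p ++ q).Sublist (p ++ a :: q) :=
      (List.Sublist.refl p).append (List.sublist_cons_self a q)
    rw [List.nodup_cons] at hnd
    rw [List.pairwise_cons] at h
    -- The tail is rearranged first, behind the longer prefix `pre ++ [a]`; then `a` is moved right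
    -- past `p`.
    have h1 : Relation.EqvGen s (pre ++ a :: t) (pre ++ a :: (p ++ q)) := by
      have := ih (p ++ q) (fun x hx => hP x (List.mem_cons_of_mem _ hx)) hperm' hnd.2 h.2
        (h'.sublist hsub) (pre ++ [a])
      simpa using this
    refine h1.trans _ _ _ ?_
    have hpt : ∀ b ∈ p, b ∈ t := fun b hb => hperm'.symm.subset (List.mem_append_left _ hb)
    -- An element of `p` stands before `a` in `l'` and after `a` in `l`, so it is unrelated to `a`
    -- in both directions.
    have hp : ∀ b ∈ p, P b ∧ a ≠ b ∧ ¬ r a b ∧ ¬ r b a := by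
      intro b hb
      refine ⟨hP b (List.mem_cons_of_mem _ (hpt b hb)), fun e => hnd.1 (e ▸ hpt b hb), ?_,
        h.1 b (hpt b hb)⟩
      exact (List.pairwise_append.1 h').2.2 b hb a List.mem_cons_self
    clear h1 h' hperm hperm' hsub ih hpt ha h
    have hPa := hP a List.mem_cons_self
    clear hP hnd
    induction p generalizing pre with
    | nil => exact .refl _
    | cons b p ihp =>
      obtain ⟨hPb, hab, h1, h2⟩ := hp b List.mem_cons_self
      have e1 := hstep pre (p ++ q) a b hPa hPb hab h1 h2
      have e2 := ihp (pre ++ [b]) (fun c hc => hp c (List.mem_cons_of_mem _ hc))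
      refine (Relation.EqvGen.rel _ _ ?_).trans _ _ _ (by simpa using e2)
      simpa using e1

theorem idxOf_lt_of_pairwise {α : Type*} [DecidableEq α] {r : α → α → Prop} {l : List α}
    (h : l.Pairwise (fun x y => ¬ r y x)) {x y : α} (hy : y ∈ l) (hx : x ∈ l) (hne : x ≠ y)
    (hr : r x y) : l.idxOf x < l.idxOf y := by
  by_contra hlt
  have hx' := List.idxOf_lt_length_iff.2 hx
  have hy' := List.idxOf_lt_length_iff.2 hy
  rcases (not_lt.1 hlt).eq_or_lt with e | e
  · exact hne ((List.idxOf_inj hx).1 e.symm)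
  · have := List.pairwise_iff_getElem.1 h _ _ hy' hx' e
    simp only [List.getElem_idxOf] at this
    exact this hr

theorem pairwise_idxOf {α : Type*} [DecidableEq α] {l : List α} (hl : l.Nodup) :
    l.Pairwise (fun x y => l.idxOf x < l.idxOf y) := by
  rw [List.pairwise_iff_getElem]
  intro i j hi hj hij
  rwa [hl.idxOf_getElem, hl.idxOf_getElem]

/-! ### Admissible orders as linear extensions of `≤_R` -/

section linext

variable {w : Equiv.Perm (Fin n)} {k : ℕ} {ρ σ : List (Finset (Fin n))}
  {R : Finset (Finset (Fin n))} {X Y Z : Finset (Fin n)} {a b : Fin n}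

theorem IsTotalOrd.packet_mem (h : IsTotalOrd w k ρ) (hX : X ∈ Inv w (k + 1))
    (hY : Y ∈ packet X) : Y ∈ ρ := by
  obtain ⟨a, ha, rfl⟩ := Finset.mem_image.1 hY
  exact (h.2 _).2 (erase_mem_Inv hX ha)

theorem IsTotalOrd.restrict_eq_of_pairwise (h : IsTotalOrd w k ρ) (hX : X ∈ Inv w (k + 1))
    {L : List (Finset (Fin n))} (hL : ∀ Y, Y ∈ L ↔ Y ∈ packet X)
    (hp : L.Pairwise (fun Y Z => ρ.idxOf Y < ρ.idxOf Z)) : restrict ρ X = L := by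
  refine List.Perm.eq_of_pairwise (le := fun Y Z => ρ.idxOf Y < ρ.idxOf Z)
    (fun Y Z _ _ h1 h2 => absurd h1 (lt_asymm h2)) ((pairwise_idxOf h.1).filter _) hp ?_
  refine (List.perm_ext_iff_of_nodup (h.1.filter _) (hp.imp ?_)).2 ?_
  · rintro Y _ h1 rfl
    exact lt_irrefl _ h1
  · intro Y
    rw [hL, List.mem_filter, decide_eq_true_eq]
    exact ⟨fun h => h.2, fun h' => ⟨h.packet_mem hX h', h'⟩⟩

theorem IsTotalOrd.restrict_eq_lex_iff (h : IsTotalOrd w k ρ) (hX : X ∈ Inv w (k + 1)) :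
    restrict ρ X = lex X ↔
      ∀ a ∈ X, ∀ b ∈ X, a < b → ρ.idxOf (X.erase b) < ρ.idxOf (X.erase a) := by
  rw [← pairwise_lex_iff (p := fun Y Z => ρ.idxOf Y < ρ.idxOf Z)]
  constructor
  · intro e
    rw [← e]
    exact (pairwise_idxOf h.1).filter _
  · exact h.restrict_eq_of_pairwise hX fun Y => mem_lex

theorem IsTotalOrd.restrict_eq_antilex_iff (h : IsTotalOrd w k ρ) (hX : X ∈ Inv w (k + 1)) :
    restrict ρ X = antilex X ↔
      ∀ a ∈ X, ∀ b ∈ X, a < b → ρ.idxOf (X.erase a) < ρ.idxOf (X.erase b) := by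
  rw [← pairwise_antilex_iff (p := fun Y Z => ρ.idxOf Y < ρ.idxOf Z)]
  constructor
  · intro e
    rw [← e]
    exact (pairwise_idxOf h.1).filter _
  · exact h.restrict_eq_of_pairwise hX fun Y => by
      rw [antilex_eq_reverse, List.mem_reverse, mem_lex]

theorem lt_of_mem_Rev (h : IsTotalOrd w k ρ) (hX : X ∈ Rev w k ρ) (ha : a ∈ X) (hb : b ∈ X)
    (hab : a < b) : ρ.idxOf (X.erase a) < ρ.idxOf (X.erase b) := by
  obtain ⟨hI, hX⟩ := Finset.mem_filter.1 hX
  exact (h.restrict_eq_antilex_iff hI).1 hX a ha b hb hab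

theorem lt_of_notMem_Rev (h : IsAdmissible w k ρ) (hI : X ∈ Inv w (k + 1)) (hX : X ∉ Rev w k ρ)
    (ha : a ∈ X) (hb : b ∈ X) (hab : a < b) : ρ.idxOf (X.erase b) < ρ.idxOf (X.erase a) := by
  refine (h.1.1.restrict_eq_lex_iff hI).1 ((h.2 X hI).resolve_right fun h' => hX ?_) a ha b hb hab
  exact Finset.mem_filter.2 ⟨hI, h'⟩

/-- The restriction to the packet is lex or antilex, so any single pair of its members decides
which. -/
theorem mem_Rev_iff (h : IsAdmissible w k ρ) (hI : X ∈ Inv w (k + 1)) (ha : a ∈ X) (hb : b ∈ X)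
    (hab : a < b) : X ∈ Rev w k ρ ↔ ρ.idxOf (X.erase a) < ρ.idxOf (X.erase b) :=
  ⟨fun h' => lt_of_mem_Rev h.1.1 h' ha hb hab, fun h' => by
    by_contra hn
    exact lt_asymm h' (lt_of_notMem_Rev h hI hn ha hb hab)⟩

theorem IsLinExt.idxOf_lt {le : Finset (Fin n) → Finset (Fin n) → Prop} (h : IsLinExt w k le ρ)
    (hY : Y ∈ Inv w k) (hZ : Z ∈ Inv w k) (hYZ : le Y Z) (hne : Y ≠ Z) :
    ρ.idxOf Y < ρ.idxOf Z :=
  (h.2 Y hY Z hZ hYZ).lt_of_ne fun e => hne ((List.idxOf_inj ((h.1.2 _).2 hY)).1 e)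

theorem GEdge.mem (hR : R ⊆ Inv w (k + 1)) (h : GEdge w k R Y Z) : Y ∈ Inv w k ∧ Z ∈ Inv w k := by
  rcases h with h | ⟨X, hX, a, b, ⟨ha, hb, hab, _⟩, rfl, rfl⟩ |
    ⟨X, hX, a, b, ⟨ha, hb, hab, _⟩, rfl, rfl⟩
  · exact h.mem
  · exact ⟨erase_mem_Inv (hR hX) ha, erase_mem_Inv (hR hX) hb⟩
  · have := (Finset.mem_sdiff.1 hX).1
    exact ⟨erase_mem_Inv this hb, erase_mem_Inv this ha⟩

/-- A list compatible with the edges of a relation on `Inv_k(w)` is a linear extension of its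
reflexive transitive closure. -/
theorem isLinExt_of_edges {r : Finset (Fin n) → Finset (Fin n) → Prop} (h : IsTotalOrd w k ρ)
    (hr : ∀ Y Z, r Y Z → ρ.idxOf Y < ρ.idxOf Z) :
    IsLinExt w k (Relation.ReflTransGen r) ρ := by
  refine ⟨h, ?_⟩
  rintro Y - Z - hYZ
  induction hYZ with
  | refl => exact le_rfl
  | tail _ h1 ih => exact ih.trans (hr _ _ h1).le

/-- Entries that are increasing in `X` are joined by a path of consecutive entries. -/
theorem transGen_of_consec {r : Fin n → Fin n → Prop} (hr : ∀ a b, Consec X a b → r a b)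
    (ha : a ∈ X) (hb : b ∈ X) (hab : a < b) : Relation.TransGen r a b := by
  induction hd : b.val - a.val using Nat.strong_induction_on generalizing a b with
  | _ d ih =>
    subst hd
    by_cases hc : ∃ c ∈ X, a < c ∧ c < b
    · obtain ⟨c, hcX, hac, hcb⟩ := hc
      have h1 : a.val < c.val := hac
      have h2 : c.val < b.val := hcb
      exact (ih _ (by omega) ha hcX hac rfl).trans (ih _ (by omega) hcX hb hcb rfl)
    · push Not at hc
      exact .single (hr a b ⟨ha, hb, hab, fun c hcX h => (hc c hcX h.1).not_gt h.2⟩)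

theorem transGen_of_mem (hX : X ∈ R) (ha : a ∈ X) (hb : b ∈ X) (hab : a < b) :
    Relation.TransGen (GEdge w k R) (X.erase a) (X.erase b) :=
  Relation.TransGen.lift (r := fun a b => Consec X a b) (fun a => X.erase a)
    (fun a b h => Or.inr (Or.inl ⟨X, hX, a, b, h, rfl, rfl⟩))
    _ _ (transGen_of_consec (fun _ _ h => h) ha hb hab)

theorem transGen_of_notMem (hI : X ∈ Inv w (k + 1)) (hX : X ∉ R) (ha : a ∈ X) (hb : b ∈ X)
    (hab : a < b) : Relation.TransGen (GEdge w k R) (X.erase b) (X.erase a) := by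
  -- Outside `R` the edges run against increasing entries, so the path is built in the reversed
  -- graph.
  have := Relation.TransGen.lift (r := fun a b => Consec X a b)
    (p := Function.swap (GEdge w k R)) (fun a => X.erase a)
    (fun a b h => Or.inr (Or.inr ⟨X, Finset.mem_sdiff.2 ⟨hI, hX⟩, a, b, h, rfl, rfl⟩))
    _ _ (transGen_of_consec (fun _ _ h => h) ha hb hab)
  exact Relation.transGen_swap.1 this

theorem IsAdmissible.idxOf_lt_of_edge (h : IsAdmissible w k ρ) (hYZ : GEdge w k (Rev w k ρ) Y Z) :
    ρ.idxOf Y < ρ.idxOf Z := by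
  have hm := hYZ.mem (Finset.filter_subset _ _)
  have hne := hYZ.ne
  rcases hYZ with h1 | ⟨X, hX, a, b, ⟨ha, hb, hab, _⟩, rfl, rfl⟩ |
    ⟨X, hX, a, b, ⟨ha, hb, hab, _⟩, rfl, rfl⟩
  · exact h.1.idxOf_lt hm.1 hm.2 (.single h1) hne
  · exact lt_of_mem_Rev h.1.1 hX ha hb hab
  · rw [Finset.mem_sdiff] at hX
    exact lt_of_notMem_Rev h hX.1 hX.2 ha hb hab

/-- This separates lex from antilex; for `k = 0` a packet has one member and the two orders
coincide. -/
theorem exists_lt_of_mem_Inv (hk : 1 ≤ k) (hI : X ∈ Inv w (k + 1)) :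
    ∃ a ∈ X, ∃ b ∈ X, a < b := by
  have hc := card_of_mem_Inv hI
  obtain ⟨a, ha, b, hb, hab⟩ := Finset.one_lt_card.1 (show 1 < X.card by omega)
  rcases lt_or_gt_of_ne hab with h | h
  exacts [⟨a, ha, b, hb, h⟩, ⟨b, hb, a, ha, h⟩]

/-- The linear extensions of `≤_R` are the admissible orders with reversal set `R`. -/
theorem isLinExt_GLE_iff (hk : 1 ≤ k) (hR : R ⊆ Inv w (k + 1)) :
    IsLinExt w k (GLE w k R) ρ ↔ IsAdmissible w k ρ ∧ Rev w k ρ = R := by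
  constructor
  · intro h
    have hmem : ∀ X ∈ R, restrict ρ X = antilex X := by
      intro X hX
      refine (h.1.restrict_eq_antilex_iff (hR hX)).2 fun a ha b hb hab => ?_
      exact h.idxOf_lt (erase_mem_Inv (hR hX) ha) (erase_mem_Inv (hR hX) hb)
        (transGen_of_mem hX ha hb hab).to_reflTransGen fun e => hab.ne (erase_inj_mem ha e)
    have hnot : ∀ X ∈ Inv w (k + 1), X ∉ R → ∀ a ∈ X, ∀ b ∈ X, a < b →
        ρ.idxOf (X.erase b) < ρ.idxOf (X.erase a) := by
      intro X hI hX a ha b hb hab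
      exact h.idxOf_lt (erase_mem_Inv hI hb) (erase_mem_Inv hI ha)
        (transGen_of_notMem hI hX ha hb hab).to_reflTransGen fun e => hab.ne' (erase_inj_mem hb e)
    refine ⟨⟨⟨h.1, fun Y hY Z hZ hYZ => h.2 Y hY Z hZ
      (Relation.ReflTransGen.mono (fun _ _ h => Or.inl h) _ _ hYZ)⟩, fun X hI => ?_⟩, ?_⟩
    · by_cases hX : X ∈ R
      · exact Or.inr (hmem X hX)
      · exact Or.inl ((h.1.restrict_eq_lex_iff hI).2 (hnot X hI hX))
    · ext X
      rw [Rev, Finset.mem_filter]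
      refine ⟨fun ⟨hI, hX⟩ => ?_, fun hX => ⟨hR hX, hmem X hX⟩⟩
      by_contra hXR
      obtain ⟨a, ha, b, hb, hab⟩ := exists_lt_of_mem_Inv hk hI
      exact lt_asymm (hnot X hI hXR a ha b hb hab)
        ((h.1.restrict_eq_antilex_iff hI).1 hX a ha b hb hab)
  · rintro ⟨h, rfl⟩
    exact isLinExt_of_edges h.1.1 fun Y Z => h.idxOf_lt_of_edge

end linext

section iso

variable {w : Equiv.Perm (Fin n)} {k : ℕ} {ρ σ : List (Finset (Fin n))}
  {R : Finset (Finset (Fin n))} {X Y Z : Finset (Fin n)} {a b : Fin n}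

/-! ### Reversal sets are consistent -/

theorem card_filter_erase_of_lt {c : Fin n} (hc : c ∈ X) (hbc : b < c) :
    ((X.erase c).filter (fun d => b < d)).card + 1 = (X.filter (fun d => b < d)).card := by
  rw [Finset.filter_erase, Finset.card_erase_add_one]
  exact Finset.mem_filter.2 ⟨hc, hbc⟩

theorem IsAdmissible.idxOf_lt_of_quasiRel (h : IsAdmissible w k ρ) (hYZ : QuasiRel w k Y Z) :
    ρ.idxOf Y < ρ.idxOf Z :=
  h.idxOf_lt_of_edge (Or.inl hYZ)

/-- For a pair `u`, `v` and a third entry `c` of `X`, membership of `X ∖ u` in the reversal set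
is decided by the elements `X ∖ {u, v}` and `X ∖ {u, c}`. -/
theorem IsAdmissible.mem_Rev_iff_idxOf_lt (h : IsAdmissible w k ρ) {u v c : Fin n}
    (hI : X.erase u ∈ Inv w (k + 1)) (hv : v ∈ X) (hc : c ∈ X) (huv : u ≠ v) (huc : u ≠ c)
    (hvc : v < c) : X.erase u ∈ Rev w k ρ ↔
      ρ.idxOf ((X.erase u).erase v) < ρ.idxOf ((X.erase u).erase c) :=
  mem_Rev_iff h hI (Finset.mem_erase.2 ⟨huv.symm, hv⟩) (Finset.mem_erase.2 ⟨huc.symm, hc⟩) hvc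

theorem IsAdmissible.notMem_Rev_iff_idxOf_lt (h : IsAdmissible w k ρ) {u v c : Fin n}
    (hI : X.erase u ∈ Inv w (k + 1)) (hv : v ∈ X) (hc : c ∈ X) (huv : u ≠ v) (huc : u ≠ c)
    (hvc : v < c) : X.erase u ∉ Rev w k ρ ↔
      ρ.idxOf ((X.erase u).erase c) < ρ.idxOf ((X.erase u).erase v) := by
  refine ⟨fun hn => lt_of_notMem_Rev h hI hn (Finset.mem_erase.2 ⟨huv.symm, hv⟩)
    (Finset.mem_erase.2 ⟨huc.symm, hc⟩) hvc, fun hlt hm => ?_⟩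
  exact lt_asymm hlt ((h.mem_Rev_iff_idxOf_lt hI hv hc huv huc hvc).1 hm)

/-- For a third entry `c`, compare `X ∖ {a, b}`, `X ∖ {a, c}` and `X ∖ {b, c}`. Membership of `X ∖
a` and of `X ∖ b` in the reversal set orders two of the pairs, and the quasi-inversion `X ∖ c`
orders the third; a violation makes the three comparisons cyclic. -/
theorem IsAdmissible.mem_Rev_of_quasiRel (hk : 1 ≤ k) (h : IsAdmissible w k ρ)
    (hYZ : QuasiRel w (k + 1) Y Z) (hZ : Z ∈ Rev w k ρ) : Y ∈ Rev w k ρ := by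
  by_contra hY
  have hm := hYZ.mem
  obtain ⟨X, a, b, hX, hq, hrel⟩ := quasiRel_iff.1 hYZ
  have ha := hq.left_mem
  have hb := hq.right_mem
  have hab := hq.lt
  obtain ⟨c, hc, hcab⟩ : ∃ c ∈ X, c ∉ ({a, b} : Finset (Fin n)) := by
    by_contra hcon
    push Not at hcon
    have := Finset.card_le_card (show X ⊆ {a, b} from hcon)
    rw [Finset.card_pair hab.ne] at this
    omega
  have hca : c ≠ a := fun e => hcab (by simp [e])
  have hcb : c ≠ b := fun e => hcab (by simp [e])
  have hqc := hq.erase hca hcb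
  have hXc : (X.erase c).card = k + 1 := by rw [Finset.card_erase_of_mem hc, hX]; rfl
  have e1 : (X.erase c).erase a = (X.erase a).erase c := Finset.erase_right_comm
  have e2 : (X.erase c).erase b = (X.erase b).erase c := Finset.erase_right_comm
  have e3 : (X.erase b).erase a = (X.erase a).erase b := Finset.erase_right_comm
  have hcons : ∀ {d}, d ∈ X → ¬ (a < d ∧ d < b) := fun hd => hq.consec.2.2.2 _ hd
  -- As `a` and `b` are consecutive, `c` lies below both or above both. Removing it keeps the parity
  -- above `b` in the first case and changes it in the second.
  rcases lt_or_gt_of_ne hcb with hlt | hgt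
  · have hlta : c < a := lt_of_le_of_ne (not_lt.1 fun h' => hcons hc ⟨h', hlt⟩) hca
    have hfil := filter_erase_lt (X := X) hlt.le
    rcases hrel with ⟨ho, rfl, rfl⟩ | ⟨he, rfl, rfl⟩
    · have h1 := (h.notMem_Rev_iff_idxOf_lt hm.1 hc hb hca.symm hab.ne hlt).1 hY
      have h2 := (h.mem_Rev_iff_idxOf_lt hm.2 hc ha hcb.symm hab.ne' hlta).1 hZ
      have h3 := h.idxOf_lt_of_quasiRel (QuasiRel.of_odd hXc hqc (by rwa [hfil]))
      rw [e1, e2] at h3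
      rw [e3] at h2
      exact lt_irrefl _ ((h1.trans h3).trans h2)
    · have h1 := (h.notMem_Rev_iff_idxOf_lt hm.1 hc ha hcb.symm hab.ne' hlta).1 hY
      have h2 := (h.mem_Rev_iff_idxOf_lt hm.2 hc hb hca.symm hab.ne hlt).1 hZ
      have h3 := h.idxOf_lt_of_quasiRel (QuasiRel.of_even hXc hqc (by rwa [hfil]))
      rw [e1, e2] at h3
      rw [e3] at h1
      exact lt_irrefl _ ((h1.trans h3).trans h2)
  · have hgta : a < c := hab.trans hgt
    have hfil := card_filter_erase_of_lt hc hgt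
    rcases hrel with ⟨ho, rfl, rfl⟩ | ⟨he, rfl, rfl⟩
    · have h1 := (h.notMem_Rev_iff_idxOf_lt hm.1 hb hc hab.ne hca.symm hgt).1 hY
      have h2 := (h.mem_Rev_iff_idxOf_lt hm.2 ha hc hab.ne' hcb.symm hgta).1 hZ
      have h3 := h.idxOf_lt_of_quasiRel (QuasiRel.of_even hXc hqc (by
        rw [← hfil] at ho
        simpa [parity_simps] using ho))
      rw [e1, e2] at h3
      rw [e3] at h2
      exact lt_irrefl _ ((h1.trans h2).trans h3)
    · have h1 := (h.notMem_Rev_iff_idxOf_lt hm.1 ha hc hab.ne' hcb.symm hgta).1 hY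
      have h2 := (h.mem_Rev_iff_idxOf_lt hm.2 hb hc hab.ne hca.symm hgt).1 hZ
      have h3 := h.idxOf_lt_of_quasiRel (QuasiRel.of_odd hXc hqc (by
        rw [← hfil] at he
        rw [← Nat.not_even_iff_odd]
        simpa [parity_simps] using he))
      rw [e1, e2] at h3
      rw [e3] at h1
      exact lt_irrefl _ ((h1.trans h2).trans h3)

/-- The reversal set of an admissible order is consistent. -/
theorem IsAdmissible.isConsistent_Rev (hk : 1 ≤ k) (h : IsAdmissible w k ρ) :
    IsConsistent w (k + 1) (Rev w k ρ) := by
  refine ⟨Finset.filter_subset _ _, ?_, fun X hX => ?_⟩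
  · rintro Y hY Z - hZY
    induction hZY using Relation.ReflTransGen.head_induction_on with
    | refl => exact hY
    | head h1 _ ih => exact h.mem_Rev_of_quasiRel hk h1 ih
  · rw [isPrefix_or_isSuffix_iff]
    intro a ha b hb c hc hab hbc hac
    have hac' := hab.trans hbc
    have hIa := erase_mem_Inv hX ha
    have hIb := erase_mem_Inv hX hb
    have hIc := erase_mem_Inv hX hc
    have e1 : (X.erase b).erase a = (X.erase a).erase b := Finset.erase_right_comm
    have e2 : (X.erase c).erase a = (X.erase a).erase c := Finset.erase_right_comm
    have e3 : (X.erase c).erase b = (X.erase b).erase c := Finset.erase_right_comm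
    have a1 := h.mem_Rev_iff_idxOf_lt hIa hb hc hab.ne hac'.ne hbc
    have a2 := h.notMem_Rev_iff_idxOf_lt hIa hb hc hab.ne hac'.ne hbc
    have b1 := h.mem_Rev_iff_idxOf_lt hIb ha hc hab.ne' hbc.ne hac'
    have b2 := h.notMem_Rev_iff_idxOf_lt hIb ha hc hab.ne' hbc.ne hac'
    have c1 := h.mem_Rev_iff_idxOf_lt hIc ha hb hac'.ne' hbc.ne' hab
    have c2 := h.notMem_Rev_iff_idxOf_lt hIc ha hb hac'.ne' hbc.ne' hab
    rw [e1] at b1 b2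
    rw [e2, e3] at c1 c2
    -- If membership changes twice, `X ∖ {a, b}`, `X ∖ {a, c}` and `X ∖ {b, c}` are in cyclic order.
    by_contra hcon
    by_cases hA : X.erase a ∈ Rev w k ρ
    · have hB : X.erase b ∉ Rev w k ρ := fun hB => hcon ⟨fun _ => hA, fun _ => hB⟩
      exact lt_irrefl _ (((a1.1 hA).trans (c1.1 (hac.1 hA))).trans (b2.1 hB))
    · have hB : X.erase b ∈ Rev w k ρ := by
        by_contra hB
        exact hcon ⟨fun h' => absurd h' hB, fun h' => absurd h' hA⟩
      exact lt_irrefl _ (((a2.1 hA).trans (b1.1 hB)).trans (c2.1 fun h' => hA (hac.2 h')))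

/-! ### Commutations -/

/-- A total order that is compatible with the edges of `G_R` is a linear extension of `≤_R`. -/
theorem isLinExt_of_pairwise (hR : R ⊆ Inv w (k + 1)) (h : IsTotalOrd w k ρ)
    (hp : ρ.Pairwise (fun Y Z => ¬ GEdge w k R Z Y)) : IsLinExt w k (GLE w k R) ρ :=
  isLinExt_of_edges h fun _ _ hYZ =>
    idxOf_lt_of_pairwise hp ((h.2 _).2 (hYZ.mem hR).2) ((h.2 _).2 (hYZ.mem hR).1) hYZ.ne hYZ

theorem IsLinExt.pairwise (h : IsLinExt w k (GLE w k R) ρ) :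
    ρ.Pairwise (fun Y Z => ¬ Relation.TransGen (GEdge w k R) Z Y) := by
  refine (pairwise_idxOf h.1.1).imp_of_mem fun hY hZ hlt hZY => ?_
  have := h.2 _ ((h.1.2 _).1 hZ) _ ((h.1.2 _).1 hY) hZY.to_reflTransGen
  exact absurd hlt this.not_gt

/-- If `X ∖ a` and `X ∖ b` are both inversions, then `X` is an inversion or a quasi-inversion at
that pair, and either way `G_R` joins them by a path. Comparability in the permanent poset is also
reachability in `G_R`. -/
theorem commutes_of_not_related (hY : Y ∈ Inv w k) (hZ : Z ∈ Inv w k) (hne : Y ≠ Z)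
    (h1 : ¬ Relation.TransGen (GEdge w k R) Y Z) (h2 : ¬ Relation.TransGen (GEdge w k R) Z Y) :
    Commutes w k Y Z := by
  have hperm : ∀ U V, U ≠ V → PermLE w k U V → Relation.TransGen (GEdge w k R) U V := by
    intro U V hUV h
    have h' := (Relation.reflTransGen_iff_eq_or_transGen.1 h).resolve_left hUV.symm
    exact Relation.TransGen.mono (fun _ _ h => Or.inl h) _ _ h'
  refine ⟨hY, hZ, fun h => h1 (hperm _ _ hne h), fun h => h2 (hperm _ _ hne.symm h), ?_⟩
  rintro ⟨X, hX, hYX, hZX⟩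
  have key : ∀ U V, U ∈ packet X → V ∈ packet X → U ≠ V →
      ∃ a ∈ X, ∃ b ∈ X, a < b ∧ ((U = X.erase a ∧ V = X.erase b) ∨
        (U = X.erase b ∧ V = X.erase a)) := by
    intro U V hU hV hUV
    obtain ⟨a, ha, rfl⟩ := Finset.mem_image.1 hU
    obtain ⟨b, hb, rfl⟩ := Finset.mem_image.1 hV
    rcases lt_or_gt_of_ne (show a ≠ b from fun e => hUV (by rw [e])) with h | h
    · exact ⟨a, ha, b, hb, h, Or.inl ⟨rfl, rfl⟩⟩
    · exact ⟨b, hb, a, ha, h, Or.inr ⟨rfl, rfl⟩⟩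
  obtain ⟨a, ha, b, hb, hab, hYZ⟩ := key Y Z hYX hZX hne
  have hrel : Relation.TransGen (GEdge w k R) (X.erase a) (X.erase b) ∨
      Relation.TransGen (GEdge w k R) (X.erase b) (X.erase a) := by
    have hIa : AllInv w (X.erase a) := by
      rcases hYZ with ⟨rfl, rfl⟩ | ⟨rfl, rfl⟩
      exacts [(mem_Inv.1 hY).2, (mem_Inv.1 hZ).2]
    have hIb : AllInv w (X.erase b) := by
      rcases hYZ with ⟨rfl, rfl⟩ | ⟨rfl, rfl⟩
      exacts [(mem_Inv.1 hZ).2, (mem_Inv.1 hY).2]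
    rcases allInv_or_quasiAt ha hb hab hIa hIb with h | hq
    · have hI : X ∈ Inv w (k + 1) := mem_Inv.2 ⟨hX, h.2⟩
      by_cases hXR : X ∈ R
      · exact Or.inl (transGen_of_mem hXR ha hb hab)
      · exact Or.inr (transGen_of_notMem hI hXR ha hb hab)
    · rcases Nat.even_or_odd (X.filter (fun c => b < c)).card with he | ho
      · exact Or.inr (.single (Or.inl (QuasiRel.of_even hX hq he)))
      · exact Or.inl (.single (Or.inl (QuasiRel.of_odd hX hq ho)))
  rcases hYZ with ⟨rfl, rfl⟩ | ⟨rfl, rfl⟩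
  exacts [hrel.elim h1 h2, hrel.elim h2 h1]

/-- Any two linear extensions of `≤_R` are related by commutations. -/
theorem IsLinExt.eqvGen_commStep (hρ : IsLinExt w k (GLE w k R) ρ) (hσ : IsLinExt w k (GLE w k R) σ) :
    Relation.EqvGen (CommStep w k) ρ σ := by
  refine eqvGen_swap (r := Relation.TransGen (GEdge w k R)) (P := fun Y => Y ∈ Inv w k)
    ?_ ρ σ (fun Y hY => (hρ.1.2 Y).1 hY) ?_ hρ.1.1 (hρ.pairwise) (hσ.pairwise) []
  · intro l₁ l₂ Y Z hY hZ hne h1 h2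
    exact ⟨l₁, l₂, Y, Z, commutes_of_not_related hY hZ hne h1 h2, rfl, rfl⟩
  · exact (List.perm_ext_iff_of_nodup hρ.1.1 hσ.1.1).2 fun Y => by rw [hρ.1.2, hσ.1.2]

theorem exists_isLinExt (hR : IsConsistent w (k + 1) R) : ∃ ρ, IsLinExt w k (GLE w k R) ρ := by
  obtain ⟨ρ, h1, h2, h3⟩ := exists_list_of_acyclic (gAcyclic hR) (Inv w k)
  exact ⟨ρ, isLinExt_of_pairwise hR.1 ⟨h1, h2⟩ h3⟩

/-! ### Packet flips -/

/-- The graphs of two sets that differ in `X` only agree outside the packet of `X`. -/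
theorem GEdge.of_ne {S : Finset (Finset (Fin n))} (hRS : ∀ T, T ≠ X → (T ∈ R ↔ T ∈ S))
    (h : GEdge w k R Y Z) (hYZ : ¬ (Y ∈ packet X ∧ Z ∈ packet X)) : GEdge w k S Y Z := by
  rcases h with h | ⟨T, hT, a, b, hc, rfl, rfl⟩ | ⟨T, hT, a, b, hc, rfl, rfl⟩
  · exact Or.inl h
  · refine Or.inr (Or.inl ⟨T, (hRS T fun e => hYZ ?_).1 hT, a, b, hc, rfl, rfl⟩)
    rw [← e]
    exact ⟨erase_mem_packet hc.1, erase_mem_packet hc.2.1⟩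
  · rw [Finset.mem_sdiff] at hT
    have hTS := (hRS T fun e => hYZ (by
      rw [← e]
      exact ⟨erase_mem_packet hc.2.1, erase_mem_packet hc.1⟩))
    exact Or.inr (Or.inr ⟨T, Finset.mem_sdiff.2 ⟨hT.1, fun h => hT.2 (hTS.2 h)⟩, a, b, hc,
      rfl, rfl⟩)

/-- If `R` and `R ∪ {X}` are consistent, the packet of `X` is convex in `G_R`. -/
theorem packet_convex (hI : X ∈ Inv w (k + 1)) (hX : X ∉ R) (hR : IsConsistent w (k + 1) R)
    (hS : IsConsistent w (k + 1) (insert X R)) {Z' : Finset (Fin n)} (hZ : Z ∈ packet X)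
    (hY : Y ∉ packet X) (hZ' : Z' ∈ packet X) (h1 : GEdge w k R Z Y) (h2 : GLE w k R Y Z') :
    False := by
  -- Edges not inside the packet do not depend on whether `X` belongs to `R`, so a `q`-path lies in
  -- both graphs.
  set q : Finset (Fin n) → Finset (Fin n) → Prop :=
    fun U V => GEdge w k R U V ∧ ¬ (U ∈ packet X ∧ V ∈ packet X) with hq
  have hRS : ∀ T, T ≠ X → (T ∈ R ↔ T ∈ insert X R) := fun T hT => by simp [hT]
  -- The path is cut at its first return to the packet.
  have hpath : ∃ Z'' ∈ packet X, Relation.TransGen q Y Z'' := by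
    clear h1
    induction h2 using Relation.ReflTransGen.head_induction_on with
    | refl => exact absurd hZ' hY
    | @head U V h1 _ ih =>
      by_cases hV : V ∈ packet X
      · exact ⟨V, hV, .single ⟨h1, fun h => hY h.1⟩⟩
      · obtain ⟨Z'', hZ'', h⟩ := ih hV
        exact ⟨Z'', hZ'', .head ⟨h1, fun h => hY h.1⟩ h⟩
  obtain ⟨Z'', hZ'', hYZ⟩ := hpath
  have hp : Relation.TransGen q Z Z'' := .head ⟨h1, fun h => hY h.2⟩ hYZ
  have hpR : Relation.TransGen (GEdge w k R) Z Z'' :=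
    Relation.TransGen.mono (fun _ _ h => h.1) _ _ hp
  have hpS : Relation.TransGen (GEdge w k (insert X R)) Z Z'' :=
    Relation.TransGen.mono (fun _ _ h => h.1.of_ne hRS h.2) _ _ hp
  obtain ⟨a, ha, rfl⟩ := Finset.mem_image.1 hZ
  obtain ⟨b, hb, rfl⟩ := Finset.mem_image.1 hZ''
  -- Whichever way the path runs along the packet, one of the two graphs contains the return path.
  rcases lt_trichotomy a b with h | rfl | h
  · exact gAcyclic hR _ (hpR.trans (transGen_of_notMem hI hX ha hb h))
  · exact gAcyclic hR _ hpR
  · exact gAcyclic hS _ (hpS.trans (transGen_of_mem (Finset.mem_insert_self X R) hb ha h))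

/-- A single step of consistent sets is realized by a packet flip. -/
theorem exists_flipStep (hI : X ∈ Inv w (k + 1)) (hX : X ∉ R) (hR : IsConsistent w (k + 1) R)
    (hS : IsConsistent w (k + 1) (insert X R)) :
    ∃ ρ σ, IsLinExt w k (GLE w k R) ρ ∧ IsLinExt w k (GLE w k (insert X R)) σ ∧
      FlipStep w k ρ σ := by
  classical
  have hRS : ∀ T, T ≠ X → (T ∈ insert X R ↔ T ∈ R) := fun T hT => by simp [hT]
  -- `D` collects the elements outside the packet that must precede some member of it, `U` all
  -- others. No edge leads from `U` to `D` or the packet by definition, and none from the packet to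
  -- `D` by convexity.
  set D := (Inv w k).filter (fun Y => Y ∉ packet X ∧ ∃ Z ∈ packet X, GLE w k R Y Z) with hD
  set U := (Inv w k).filter (fun Y => Y ∉ packet X ∧ ¬ ∃ Z ∈ packet X, GLE w k R Y Z) with hU
  obtain ⟨lD, hD1, hD2, hD3⟩ := exists_list_of_acyclic (gAcyclic hR) D
  obtain ⟨lU, hU1, hU2, hU3⟩ := exists_list_of_acyclic (gAcyclic hR) U
  -- The two graphs agree on edges not inside the packet, so the same `lD` and `lU` serve for `R`
  -- with the lex order and for `insert X R` with the antilex order.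
  have main : ∀ S L, S ⊆ Inv w (k + 1) → (∀ Y Z, ¬ (Y ∈ packet X ∧ Z ∈ packet X) →
      GEdge w k S Y Z → GEdge w k R Y Z) → L.Nodup → (∀ Y, Y ∈ L ↔ Y ∈ packet X) →
      L.Pairwise (fun Y Z => ¬ GEdge w k S Z Y) →
      IsLinExt w k (GLE w k S) (lD ++ L ++ lU) := by
    intro S L hSI hSR hL1 hL2 hL3
    have hDp : ∀ Y ∈ lD, Y ∉ packet X ∧ ∃ Z ∈ packet X, GLE w k R Y Z := fun Y hY =>
      (Finset.mem_filter.1 ((hD2 Y).1 hY)).2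
    have hUp : ∀ Y ∈ lU, Y ∉ packet X ∧ ¬ ∃ Z ∈ packet X, GLE w k R Y Z := fun Y hY =>
      (Finset.mem_filter.1 ((hU2 Y).1 hY)).2
    refine isLinExt_of_pairwise hSI ⟨?_, fun Y => ?_⟩ ?_
    · rw [List.nodup_append', List.nodup_append']
      refine ⟨⟨hD1, hL1, fun Y h1 h2 => (hDp Y h1).1 ((hL2 Y).1 h2)⟩, hU1, fun Y h1 h2 => ?_⟩
      rcases List.mem_append.1 h1 with h1 | h1
      · exact (hUp Y h2).2 (hDp Y h1).2
      · exact (hUp Y h2).1 ((hL2 Y).1 h1)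
    · rw [List.mem_append, List.mem_append, hD2, hL2, hU2, hD, hU, Finset.mem_filter,
        Finset.mem_filter]
      have : Y ∈ packet X → Y ∈ Inv w k := by
        intro h
        obtain ⟨a, ha, rfl⟩ := Finset.mem_image.1 h
        exact erase_mem_Inv hI ha
      have taut : ∀ p q r : Prop, (q → p) →
          (((p ∧ ¬ q ∧ r) ∨ q) ∨ p ∧ ¬ q ∧ ¬ r ↔ p) := by
        intros
        tauto
      exact taut _ _ _ this
    · rw [List.pairwise_append, List.pairwise_append]
      refine ⟨⟨?_, hL3, ?_⟩, ?_, ?_⟩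
      · refine hD3.imp_of_mem fun hY _ h h' => h (hSR _ _ (fun h => (hDp _ hY).1 h.2) h')
      · intro Y hY Z hZ h
        obtain ⟨h1, Z', hZ', h2⟩ := hDp Y hY
        exact packet_convex hI hX hR hS ((hL2 Z).1 hZ) h1 hZ' (hSR _ _ (fun h => h1 h.2) h) h2
      · refine hU3.imp_of_mem fun hY _ h h' => h (hSR _ _ (fun h => (hUp _ hY).1 h.2) h')
      · intro Y hY Z hZ h
        obtain ⟨h1, h2⟩ := hUp Z hZ
        have h3 := hSR _ _ (fun h => h1 h.1) h
        rcases List.mem_append.1 hY with hY | hY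
        · obtain ⟨_, Z', hZ', h4⟩ := hDp Y hY
          exact h2 ⟨Z', hZ', h4.head h3⟩
        · exact h2 ⟨Y, (hL2 Y).1 hY, .single h3⟩
  refine ⟨lD ++ lex X ++ lU, lD ++ antilex X ++ lU, ?_, ?_, lD, lU, X, hI, rfl, rfl⟩
  · refine main R _ hR.1 (fun _ _ _ h => h) (lex_nodup X) (fun Y => mem_lex) ?_
    refine pairwise_lex_iff.2 fun a ha b hb hab h => ?_
    exact gAcyclic hR _ ((transGen_of_notMem hI hX ha hb hab).tail h)
  · refine main (insert X R) _ hS.1 (fun _ _ h h' => h'.of_ne hRS h) ?_ (fun Y => ?_) ?_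
    · rw [antilex_eq_reverse, List.nodup_reverse]
      exact lex_nodup X
    · rw [antilex_eq_reverse, List.mem_reverse, mem_lex]
    · refine pairwise_antilex_iff.2 fun a ha b hb hab h => ?_
      exact gAcyclic hS _ ((transGen_of_mem (Finset.mem_insert_self X R) ha hb hab).tail h)

end iso

section iso

variable {w : Equiv.Perm (Fin n)} {k : ℕ} {ρ σ : List (Finset (Fin n))}
  {R : Finset (Finset (Fin n))} {X Y Z : Finset (Fin n)} {a b : Fin n}

/-! ### Steps preserve admissibility -/

theorem IsTotalOrd.of_perm (h : IsTotalOrd w k ρ) (hp : ρ.Perm σ) : IsTotalOrd w k σ :=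
  ⟨hp.nodup_iff.1 h.1, fun X => by rw [← hp.mem_iff, h.2]⟩

theorem isLinExt_permLE_of_pairwise (h : IsTotalOrd w k ρ)
    (hp : ρ.Pairwise (fun Y Z => ¬ QuasiRel w k Z Y)) : IsLinExt w k (PermLE w k) ρ :=
  isLinExt_of_edges h fun _ _ hYZ =>
    idxOf_lt_of_pairwise hp ((h.2 _).2 hYZ.mem.2) ((h.2 _).2 hYZ.mem.1)
      (GEdge.ne (R := ∅) (Or.inl hYZ)) hYZ

theorem IsLinExt.pairwise_quasiRel (h : IsLinExt w k (PermLE w k) ρ) :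
    ρ.Pairwise (fun Y Z => ¬ QuasiRel w k Z Y) :=
  (pairwise_idxOf h.1.1).imp fun hlt hZY =>
    absurd hlt (h.2 _ hZY.mem.1 _ hZY.mem.2 (.single hZY)).not_gt

theorem IsAdmissible.commStep (h : IsAdmissible w k ρ) (hs : CommStep w k ρ σ) :
    IsAdmissible w k σ := by
  have hperm := step_perm (Or.inl hs)
  refine ⟨isLinExt_permLE_of_pairwise (h.1.1.of_perm hperm) ?_, fun X hX => ?_⟩
  · have hp := h.1.pairwise_quasiRel
    obtain ⟨l₁, l₂, Y, Z, hc, rfl, rfl⟩ := hs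
    -- After the exchange `Z` precedes `Y`; this is the only new constraint.
    have hYZ : ¬ QuasiRel w k Y Z := fun h' => hc.2.2.1 (.single h')
    simp only [List.pairwise_append, List.pairwise_cons, List.mem_append, List.mem_cons,
      List.not_mem_nil, or_false, forall_eq_or_imp, forall_eq] at hp ⊢
    grind
  · rw [← restrict_comm hs (card_of_mem_Inv hX)]
    exact h.2 X hX

/-- No quasi-inversion relation joins two elements of the packet of an inversion. -/
theorem not_quasiRel_of_packet (hX : X ∈ Inv w (k + 1)) (hY : Y ∈ packet X) (hZ : Z ∈ packet X) :
    ¬ QuasiRel w k Y Z := by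
  intro h
  have hne : Y ≠ Z := GEdge.ne (R := ∅) (Or.inl h)
  obtain ⟨T, a, b, hT, hq, h⟩ := quasiRel_iff.1 h
  -- Two members shared by the packets of `X` and `T` would force `X = T`, but only `X` is an
  -- inversion.
  have hTX : X ≠ T := by
    rintro rfl
    exact hq.not_allInv (mem_Inv.1 hX).2
  have ha := erase_mem_packet hq.left_mem
  have hb := erase_mem_packet hq.right_mem
  rcases h with ⟨_, rfl, rfl⟩ | ⟨_, rfl, rfl⟩
  · exact hne (packet_inter (card_of_mem_Inv hX) hT hTX hY ha hZ hb)
  · exact hne (packet_inter (card_of_mem_Inv hX) hT hTX hY hb hZ ha)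

/-- A packet flip at `X` does not change the restriction to any other packet. -/
theorem restrict_flip_of_ne {l₁ l₂ : List (Finset (Fin n))} {T : Finset (Fin n)}
    (hX : X.card = k + 1) (hT : T.card = k + 1) (hne : X ≠ T) :
    restrict (l₁ ++ antilex X ++ l₂) T = restrict (l₁ ++ lex X ++ l₂) T := by
  have hrev : ((lex X).filter (fun Y => decide (Y ∈ packet T))).reverse =
      (lex X).filter (fun Y => decide (Y ∈ packet T)) := by
    have hall : ∀ Y ∈ (lex X).filter (fun Y => decide (Y ∈ packet T)),
        ∀ Z ∈ (lex X).filter (fun Y => decide (Y ∈ packet T)), Y = Z := by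
      intro Y hY Z hZ
      simp only [List.mem_filter, decide_eq_true_eq, mem_lex] at hY hZ
      exact packet_inter hX hT hne hY.1 hY.2 hZ.1 hZ.2
    generalize (lex X).filter (fun Y => decide (Y ∈ packet T)) = L at hall
    cases L with
    | nil => rfl
    | cons a t =>
      rw [List.eq_replicate_of_mem (a := a) (l := a :: t)
        (fun b hb => hall b hb a List.mem_cons_self), List.reverse_replicate]
  simp only [restrict, List.filter_append, antilex_eq_reverse, List.filter_reverse, hrev]

theorem restrict_append_self {l₁ l₂ L : List (Finset (Fin n))} (hn : (l₁ ++ L ++ l₂).Nodup)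
    (hL : ∀ Y, Y ∈ L ↔ Y ∈ packet X) : restrict (l₁ ++ L ++ l₂) X = L := by
  rw [List.nodup_append', List.nodup_append'] at hn
  have e1 : l₁.filter (fun Y => decide (Y ∈ packet X)) = [] := by
    simp only [List.filter_eq_nil_iff, decide_eq_true_eq]
    exact fun Y hY h => hn.1.2.2 hY ((hL Y).2 h)
  have e2 : l₂.filter (fun Y => decide (Y ∈ packet X)) = [] := by
    simp only [List.filter_eq_nil_iff, decide_eq_true_eq]
    exact fun Y hY h => hn.2.2 (List.mem_append_right _ ((hL Y).2 h)) hY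
  have e3 : L.filter (fun Y => decide (Y ∈ packet X)) = L := by
    simp only [List.filter_eq_self, decide_eq_true_eq]
    exact fun Y hY => (hL Y).1 hY
  simp only [restrict, List.filter_append, e1, e2, e3, List.nil_append, List.append_nil]

/-- A packet flip preserves admissibility and adds one element to the reversal set. -/
theorem IsAdmissible.flipStep (h : IsAdmissible w k ρ) (hs : FlipStep w k ρ σ) :
    IsAdmissible w k σ ∧ ∃ X, Rev w k σ = insert X (Rev w k ρ) := by
  have hperm := step_perm (Or.inr hs)
  have hσ := h.1.1.of_perm hperm
  have hp := h.1.pairwise_quasiRel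
  obtain ⟨l₁, l₂, X, hX, rfl, rfl⟩ := hs
  have hmem : ∀ Y, Y ∈ antilex X ↔ Y ∈ packet X := fun Y => by
    rw [antilex_eq_reverse, List.mem_reverse, mem_lex]
  have hself := restrict_append_self hσ.1 hmem
  have hne : ∀ T ∈ Inv w (k + 1), X ≠ T →
      restrict (l₁ ++ antilex X ++ l₂) T = restrict (l₁ ++ lex X ++ l₂) T := fun T hT =>
    restrict_flip_of_ne (card_of_mem_Inv hX) (card_of_mem_Inv hT)
  refine ⟨⟨isLinExt_permLE_of_pairwise hσ ?_, fun T hT => ?_⟩, X, ?_⟩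
  · rw [List.pairwise_append, List.pairwise_append] at hp ⊢
    refine ⟨⟨hp.1.1, ?_, fun Y hY Z hZ => hp.1.2.2 Y hY Z (mem_lex.2 ((hmem Z).1 hZ))⟩, hp.2.1,
      fun Y hY Z hZ => hp.2.2 Y ?_ Z hZ⟩
    · exact pairwise_antilex_iff.2 fun a ha b hb _ =>
        not_quasiRel_of_packet hX (erase_mem_packet hb) (erase_mem_packet ha)
    · rw [List.mem_append] at hY ⊢
      exact hY.imp_right fun h => mem_lex.2 ((hmem Y).1 h)
  · by_cases e : X = T
    · subst e
      exact Or.inr hself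
    · rw [hne T hT e]
      exact h.2 T hT
  · ext T
    rw [Finset.mem_insert, Rev, Rev, Finset.mem_filter, Finset.mem_filter]
    by_cases e : X = T
    · subst e
      exact ⟨fun _ => Or.inl rfl, fun _ => ⟨hX, hself⟩⟩
    · constructor
      · rintro ⟨hT, h'⟩
        exact Or.inr ⟨hT, by rw [← hne T hT e]; exact h'⟩
      · rintro (rfl | ⟨hT, h'⟩)
        · exact absurd rfl e
        · exact ⟨hT, by rw [hne T hT e]; exact h'⟩

theorem IsAdmissible.reach (h : IsAdmissible w k ρ) (hr : Reach w k ρ σ) : IsAdmissible w k σ := by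
  induction hr with
  | refl => exact h
  | tail _ hs ih => exact hs.elim ih.commStep fun hs => (ih.flipStep hs).1

/-! ### The isomorphism -/

/-- The reversal set of an admissible order, as a consistent set. -/
def revC (hk : 1 ≤ k) (ρ : Adm w k) : C w (k + 1) :=
  ⟨Rev w k ρ.1, ρ.2.isConsistent_Rev hk⟩

/-- Orders with the same reversal set `R` are linear extensions of the same `≤_R`, hence related by
commutations; and a commutation leaves every packet restriction unchanged. -/
theorem revC_eq_iff (hk : 1 ≤ k) (ρ σ : Adm w k) :
    revC hk ρ = revC hk σ ↔ Relation.EqvGen (CommStep w k) ρ.1 σ.1 := by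
  constructor
  · intro h
    have h' : Rev w k ρ.1 = Rev w k σ.1 := congrArg Subtype.val h
    have hR := (Finset.filter_subset _ _ : Rev w k σ.1 ⊆ Inv w (k + 1))
    exact ((isLinExt_GLE_iff hk hR).2 ⟨ρ.2, h'⟩).eqvGen_commStep
      ((isLinExt_GLE_iff hk hR).2 ⟨σ.2, rfl⟩)
  · intro h
    refine Subtype.ext ?_
    change Rev w k ρ.1 = Rev w k σ.1
    generalize ρ.1 = ρ', σ.1 = σ' at h
    induction h with
    | rel _ _ h => exact Rev_comm h
    | refl => rfl
    | symm _ _ _ ih => exact ih.symm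
    | trans _ _ _ _ _ ih1 ih2 => exact ih1.trans ih2

theorem exists_revC_eq (hk : 1 ≤ k) (R : C w (k + 1)) : ∃ ρ : Adm w k, revC hk ρ = R := by
  obtain ⟨ρ, hρ⟩ := exists_isLinExt R.2
  have := (isLinExt_GLE_iff hk R.2.1).1 hρ
  exact ⟨⟨ρ, this.1⟩, Subtype.ext this.2⟩

theorem revC_le_of_reach (hk : 1 ≤ k) (ρ σ : Adm w k) (h : Reach w k ρ.1 σ.1) :
    revC hk ρ ≤ revC hk σ := by
  obtain ⟨σ, hσ⟩ := σ
  simp only at h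
  induction h with
  | refl => exact le_rfl
  | @tail τ σ hr hs ih =>
    have hτ := ρ.2.reach hr
    refine (ih hτ).trans ?_
    rcases hs with hs | hs
    · exact le_of_eq (Subtype.ext (Rev_comm hs))
    · obtain ⟨_, X, hX⟩ := hτ.flipStep hs
      by_cases hXR : X ∈ Rev w k τ
      · rw [Finset.insert_eq_of_mem hXR] at hX
        exact le_of_eq (Subtype.ext hX.symm)
      · exact Relation.ReflTransGen.single ⟨X, hXR, hX⟩

/-- Each single step is realized by a flip between suitable representatives. The induction runs over
all representatives of a set at once, since any two of them are related by commutations. -/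
theorem reach_of_revC_le (hk : 1 ≤ k) (ρ σ : Adm w k) (h : revC hk ρ ≤ revC hk σ) :
    Reach w k ρ.1 σ.1 := by
  have key : ∀ S : C w (k + 1), Relation.ReflTransGen SingleStep (revC hk ρ) S →
      ∀ σ : Adm w k, revC hk σ = S → Reach w k ρ.1 σ.1 := by
    intro S hS
    induction hS with
    | refl => exact fun σ hσ => (reach_of_eqv ((revC_eq_iff hk _ _).1 hσ)).2
    | @tail S T _ hs ih =>
      intro σ hσ
      obtain ⟨X, hX, hT⟩ := hs
      have hTc := T.2
      rw [hT] at hTc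
      obtain ⟨τ, τ', h1, h2, hflip⟩ :=
        exists_flipStep (hTc.1 (Finset.mem_insert_self X _)) hX S.2 hTc
      have h1' := (isLinExt_GLE_iff hk S.2.1).1 h1
      have h2' := (isLinExt_GLE_iff hk hTc.1).1 h2
      have e1 := ih ⟨τ, h1'.1⟩ (Subtype.ext h1'.2)
      have e2 : revC hk ⟨τ', h2'.1⟩ = revC hk σ := by
        rw [hσ]
        exact Subtype.ext (h2'.2.trans hT.symm)
      exact (e1.tail (Or.inr hflip)).trans (reach_of_eqv ((revC_eq_iff hk _ _).1 e2)).1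
  exact key _ h σ rfl

/-- The map `[ρ] ↦ Rev(ρ)` on commutation classes. -/
def revB (hk : 1 ≤ k) : B w k → C w (k + 1) :=
  Quotient.lift (revC hk) fun ρ σ h => (revC_eq_iff hk ρ σ).2 h

theorem revB_bijective (hk : 1 ≤ k) : Function.Bijective (revB (w := w) hk) := by
  constructor
  · rintro ⟨ρ⟩ ⟨σ⟩ h
    exact Quotient.sound (s := commSetoid w k) ((revC_eq_iff hk ρ σ).1 h)
  · intro R
    obtain ⟨ρ, hρ⟩ := exists_revC_eq hk R
    exact ⟨cls ρ, hρ⟩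

/-- The isomorphism `[ρ] ↦ Rev(ρ)` from `B_w(n,k)` to `C_w(n,k+1)`. -/
noncomputable def revIso (hk : 1 ≤ k) : B w k ≃o C w (k + 1) where
  toEquiv := Equiv.ofBijective (revB hk) (revB_bijective hk)
  map_rel_iff' := by
    rintro ⟨ρ⟩ ⟨σ⟩
    exact ⟨reach_of_revC_le hk ρ σ, revC_le_of_reach hk ρ σ⟩

end iso

end HigherBruhat

theorem mainTheorem4 (n k : ℕ) (hk : 1 ≤ k) (w : Equiv.Perm (Fin n)) :
    (∀ R : HigherBruhat.C w (k + 1), HigherBruhat.GAcyclic w k R.1) ∧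
    ∃ e : HigherBruhat.B w k ≃o HigherBruhat.C w (k + 1),
      (∀ ρ : HigherBruhat.Adm w k, (e (HigherBruhat.cls ρ)).1 = HigherBruhat.Rev w k ρ.1) ∧
      ∀ R : HigherBruhat.C w (k + 1),
        {ρ : List (Finset (Fin n)) |
            ∃ h : HigherBruhat.IsAdmissible w k ρ, HigherBruhat.cls ⟨ρ, h⟩ = e.symm R} =
          {ρ | HigherBruhat.IsLinExt w k (HigherBruhat.GLE w k R.1) ρ} := by
  refine ⟨fun R => HigherBruhat.gAcyclic R.2, HigherBruhat.revIso hk, fun ρ => rfl, fun R => ?_⟩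
  ext ρ
  rw [Set.mem_ofPred_eq, Set.mem_ofPred_eq, HigherBruhat.isLinExt_GLE_iff hk R.2.1]
  constructor
  · rintro ⟨h, e⟩
    rw [OrderIso.eq_symm_apply] at e
    exact ⟨h, congrArg Subtype.val e⟩
  · rintro ⟨h, e⟩
    refine ⟨h, ?_⟩
    rw [OrderIso.eq_symm_apply]
    exact Subtype.ext e
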